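/- Let $F=\frac1N\sum_{i=1}^N F_i:\mathbb R^d\to\mathbb R$ with $N\ge 1$ and all $F_i$ of class $C^2$. For a finite non-empty batch $S$ of indices in $\{1,\dots,N\}$ (repetitions allowed) let $F_S=\frac1{|S|}\sum_{i\in S}F_i$. Assume: 1. there are $M\ge m>0$ with $mI\preceq\nabla^2F(x)\preceq MI$ for all $x$; put $\kappa=M/m$; 2. $0\preceq\nabla^2F_S(x)\preceq MI$ for every such batch $S$ and all $x$; 3. almost surely $\|\nabla F(x_k)\|\le\gamma$ for all $k\ge0$, where $\gamma>0$ and $(x_k)$ are the iterates defined below; 4. $F$ is standard self-concordant: it is convex, of class $C^3$, and $|\nabla^3F(x)[h,h,h]|\le 2\,(\nabla^2F(x)[h,h])^{3/2}$ for all $x,h$. Let $G$ satisfy $\|\nabla F_i(x)\|\le G(x)$ for all $i,x$, let $x^*$ be a minimizer of $F$, and let $0<\nu<1$, $\nu\gamma<1$ and $0<\varepsilon,p,\delta<1$. Start from any $x_0\in\mathbb R^d$. In iteration $k$ the sizes $|S_k|$ and $|X_k|$ are chosen as functions of the draws of the earlier iterations; then the gradient batch $S_k$ and the Hessian batch $X_k$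 are drawn, with all draws of all batches and all iterations uniform on $\{1,\dots,N\}$ and independent. With $g_k=\nabla F_{S_k}(x_k)$, $\rho_k=g_k^T\nabla F(x_k)$, $\hat\delta_{k,\varepsilon}=\sqrt{g_k^T\nabla^2F_{X_k}(x_k)g_k}\,/\sqrt{1-\varepsilon}$ and $t_{k,\varepsilon}=\dfrac{\rho_k}{(\rho_k+\hat\delta_{k,\varepsilon})\hat\delta_{k,\varepsilon}}$ (read as $0$ if the denominator is $0$), put $x_{k+1}=x_k-t_{k,\varepsilon}g_k$. Let $k\ge 0$ be such that almost surely $|X_k|\ge 16\kappa^2\ln(2d/p)/\varepsilon^2$ (for $d\ge1$). If almost surely $$|S_k|\ \ge\ \Big[\frac{G(x_k)}{\nu\|\nabla F_{S_k}(x_k)\|}\Big]^2\Big(1+\sqrt{8\ln\tfrac1\delta}\Big)^2 \qquad(*)$$ (multiplied out, so that for $\nabla F_{S_k}(x_k)=0$ it means $G(x_k)=0$), then with probability at least $(1-p)(1-\delta)$ $$F(x_{k+1})-F(x^*)\le\rho\,(F(x_k)-F(x^*)),\qquad \rho=1-\frac{m(1-\nu)^2(1-\varepsilon)}{2(1+\nu^2)M\left(1+\frac{\gamma}{\sqrt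 m}\right)}.$$ More generally, whether or not $(*)$ holds almost surely, the event that $(*)$ fails or this inequality holds has probability at least $(1-p)(1-\delta)$. -/

import Mathlib

open MeasureTheory ProbabilityTheory

noncomputable section

/-- The Hessian of `f` at `x`, as a linear operator: the derivative of the gradient map. -/
def hess {d : ℕ} (f : EuclideanSpace ℝ (Fin d) → ℝ) (x : EuclideanSpace ℝ (Fin d)) :
    EuclideanSpace ℝ (Fin d) →L[ℝ] EuclideanSpace ℝ (Fin d) :=
  fderiv ℝ (gradient f) x

/-- Self-concordance with constant `c`, for a convex function of class `C³` on the whole space: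
`|∇³f(x)[h,h,h]| ≤ c (∇²f(x)[h,h])^(3/2)`. -/
structure SelfConcordant {d : ℕ} (c : ℝ) (f : EuclideanSpace ℝ (Fin d) → ℝ) : Prop where
  convex : ConvexOn ℝ Set.univ f
  smooth : ContDiff ℝ 3 f
  bound : ∀ x h : EuclideanSpace ℝ (Fin d),
    |iteratedFDeriv ℝ 3 f x (fun _ => h)| ≤
      c * (iteratedFDeriv ℝ 2 f x (fun _ => h)) ^ (3 / 2 : ℝ)

/-- The full objective `F = (1/N) ∑ᵢ Fᵢ`. -/
def fullLoss {d N : ℕ} (f : Fin N → EuclideanSpace ℝ (Fin d) → ℝ)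
    (x : EuclideanSpace ℝ (Fin d)) : ℝ :=
  (1 / (N : ℝ)) * ∑ i, f i x

/-- The empirical objective `F_S = (1/|S|) ∑_{i ∈ S} Fᵢ` of the batch `S = (σ 0, …, σ (s - 1))`
of size `s` (a batch may contain the same index several times). -/
def batchLoss {d N : ℕ} (f : Fin N → EuclideanSpace ℝ (Fin d) → ℝ) (σ : ℕ → Fin N) (s : ℕ)
    (x : EuclideanSpace ℝ (Fin d)) : ℝ :=
  (1 / (s : ℝ)) * ∑ j ∈ Finset.range s, f (σ j) x

/-- Hessian regularity: `m I ≼ ∇²F(x) ≼ M I` for all `x` (Loewner order), with `M ≥ m > 0`. -/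
def HessianRegular {d N : ℕ} (f : Fin N → EuclideanSpace ℝ (Fin d) → ℝ) (m M : ℝ) : Prop :=
  0 < m ∧ m ≤ M ∧ ∀ x : EuclideanSpace ℝ (Fin d),
    m • (1 : EuclideanSpace ℝ (Fin d) →L[ℝ] EuclideanSpace ℝ (Fin d)) ≤ hess (fullLoss f) x ∧
    hess (fullLoss f) x ≤ M • (1 : EuclideanSpace ℝ (Fin d) →L[ℝ] EuclideanSpace ℝ (Fin d))

/-- Uniform regularity of the sampled Hessians: `0 ≼ ∇²F_S(x) ≼ M I` for every sample batch `S` and all `x`. -/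
def SampledHessianRegular {d N : ℕ} (f : Fin N → EuclideanSpace ℝ (Fin d) → ℝ) (M : ℝ) : Prop :=
  ∀ (s : ℕ), 0 < s → ∀ (σ : ℕ → Fin N) (x : EuclideanSpace ℝ (Fin d)),
    0 ≤ hess (batchLoss f σ s) x ∧
    hess (batchLoss f σ s) x ≤ M • (1 : EuclideanSpace ℝ (Fin d) →L[ℝ] EuclideanSpace ℝ (Fin d))

/-- The step size `ρ / ((ρ + δ̂_ε) δ̂_ε)` at `x` for the gradient batch `S = (σ 0, …, σ (s - 1))`
and the Hessian batch `X = (τ 0, …, τ (r - 1))`, where `ρ = ⟨∇F_S(x), ∇F(x)⟩`,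
`δ̂ = √⟨∇F_S(x), ∇²F_X(x) ∇F_S(x)⟩` and `δ̂_ε = δ̂ / √(1 - ε)`. -/
def stepSize {d N : ℕ} (f : Fin N → EuclideanSpace ℝ (Fin d) → ℝ) (ε : ℝ)
    (σ : ℕ → Fin N) (s : ℕ) (τ : ℕ → Fin N) (r : ℕ) (x : EuclideanSpace ℝ (Fin d)) : ℝ :=
  let g := gradient (batchLoss f σ s) x
  let ρ := inner ℝ g (gradient (fullLoss f) x)
  let δε := √(inner ℝ g (hess (batchLoss f τ r) x g)) / √(1 - ε)
  ρ / ((ρ + δε) * δε)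

/-- The iterates started at `x₀`. In iteration `k` the gradient batch `S_k` consists of the first
`s k ω` of the draws `ξ k 0 ω, ξ k 1 ω, …`, the Hessian batch `X_k` of the first `r k ω` of the
draws `ζ k 0 ω, ζ k 1 ω, …`, and `x_{k+1} = x_k - t_{k,ε} ∇F_{S_k}(x_k)`. -/
def iterates {d N : ℕ} {Ω : Type*} (f : Fin N → EuclideanSpace ℝ (Fin d) → ℝ) (ε : ℝ)
    (x₀ : EuclideanSpace ℝ (Fin d)) (ξ ζ : ℕ → ℕ → Ω → Fin N) (s r : ℕ → Ω → ℕ) :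
    ℕ → Ω → EuclideanSpace ℝ (Fin d)
  | 0 => fun _ => x₀
  | k + 1 => fun ω =>
      let x := iterates f ε x₀ ξ ζ s r k ω
      x - stepSize f ε (fun j => ξ k j ω) (s k ω) (fun j => ζ k j ω) (r k ω) x •
        gradient (batchLoss f (fun j => ξ k j ω) (s k ω)) x

/-- All draws, for all iterations and for both kinds of batches, are mutually independent and
uniformly distributed on the `N` indices. -/
structure UniformDraws {N : ℕ} {Ω : Type*} [MeasurableSpace Ω] (μ : Measure Ω)
    (ξ ζ : ℕ → ℕ → Ω → Fin N) : Prop where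
  measurable_grad : ∀ k j, Measurable (ξ k j)
  measurable_hess : ∀ k j, Measurable (ζ k j)
  uniform_grad : ∀ k j, μ.map (ξ k j) = uniformOn Set.univ
  uniform_hess : ∀ k j, μ.map (ζ k j) = uniformOn Set.univ
  indep : iIndepFun (fun q : (ℕ × ℕ) ⊕ (ℕ × ℕ) =>
    Sum.elim (fun a => ξ a.1 a.2) (fun a => ζ a.1 a.2) q) μ

/-- The σ-algebra of the history before iteration `k`: it is generated by all draws of the
iterations `i < k`. -/
@[reducible] def history {N : ℕ} {Ω : Type*} (ξ ζ : ℕ → ℕ → Ω → Fin N) (k : ℕ) : MeasurableSpace Ω :=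
  ⨆ (i : ℕ) (_ : i < k) (j : ℕ),
    MeasurableSpace.comap (ξ i j) ⊤ ⊔ MeasurableSpace.comap (ζ i j) ⊤

/-- The size `s` of the gradient batch `S = (σ 0, …, σ (s - 1))` satisfies
`s ≥ [G(x) / (ν ‖∇F_S(x)‖)]² (1 + √(8 ln (1/δ)))²`. The denominator is multiplied out, so that
for `∇F_S(x) = 0` the condition can only hold if `G(x) = 0`. -/
def GradBatchLargeEnough {d N : ℕ} (f : Fin N → EuclideanSpace ℝ (Fin d) → ℝ)
    (G : EuclideanSpace ℝ (Fin d) → ℝ) (ν δ : ℝ) (σ : ℕ → Fin N) (s : ℕ)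
    (x : EuclideanSpace ℝ (Fin d)) : Prop :=
  (G x) ^ 2 * (1 + √(8 * Real.log (1 / δ))) ^ 2 ≤
    (s : ℝ) * (ν * ‖gradient (batchLoss f σ s) x‖) ^ 2

/-- The size `r` of the Hessian batch satisfies `r ≥ 16 κ² ln (2 d / p) / ε²` with the condition
number `κ = M / m` and the dimension `d`. -/
def HessBatchLargeEnough (d : ℕ) (m M ε p : ℝ) (r : ℕ) : Prop :=
  16 * (M / m) ^ 2 * Real.log (2 * (d : ℝ) / p) / ε ^ 2 ≤ (r : ℝ)

/-- The contraction factor. -/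
def contractionFactor (m M γ ν ε : ℝ) : ℝ :=
  1 - m * (1 - ν) ^ 2 * (1 - ε) / (2 * (1 + ν ^ 2) * M * (1 + γ / √m))

end

open MeasureTheory ProbabilityTheory

/-! ### Self-concordance and strong convexity in one variable. -/

section OneDimensional

/-! Deterministic part. Let v = ∇F(x), let g be the sampled gradient, ρ = ⟨g, v⟩, and let D be the
estimated local norm of g. If D² ≥ ⟨∇²F(x)g, g⟩, self-concordance gives F(x - tg) ≤ F(x) - tρ - tD -
log(1 - tD) (`selfConcordant_descent`). The step size minimizes the right side, and the decrease is
at least η - log(1 + η) ≥ η²/(4(1 + η)) with η = ρ/D. From ‖g - v‖ ≤ ν‖g‖ and D²(1 - ε) ≤ M‖g‖²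
follows η² ≥ (1 - ν²)(1 - ε)‖v‖²/M, while Cauchy–Schwarz and D² ≥ m‖g‖² give η ≤ γ/√m. The
Polyak–Łojasiewicz inequality 2m(F(x) - F(x*)) ≤ ‖v‖² turns the decrease into a contraction
(`contraction_step`).

Random part. The condition (*) involves the very batch that is drawn, so conditioning on it would
spoil uniformity. Instead `GradSampleAccurate` bounds the deviation by the batch size and G(x)
alone; given the past it has probability at least 1 - δ, whether or not (*) holds. Then (*) enters
deterministically and converts it into the relative error ν (`norm_batch_gradient_sub_le`). The tail
bound is a dimension-free Hoeffding inequality for vectors (`measureReal_norm_sum_gt_le`). For the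
Hessian only the curvature along g matters, and g is fixed once the past and the gradient batch are
given, so scalar Hoeffding suffices (`measureReal_hessSampleAccurate_ge`).

Conditioning is elementary: with finitely many indices the iterates take countably many values, and
`mul_measureReal_preimage_le` sums over them. -/

theorem monotoneOn_of_hasDerivAt_nonneg {a b : ℝ} {φ φ' : ℝ → ℝ}
    (h : ∀ t ∈ Set.Icc a b, HasDerivAt φ (φ' t) t) (h0 : ∀ t ∈ Set.Icc a b, 0 ≤ φ' t) :
    MonotoneOn φ (Set.Icc a b) := by
  refine monotoneOn_of_deriv_nonneg (convex_Icc a b)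
    (fun t ht => (h t ht).continuousAt.continuousWithinAt)
    (fun t ht => (h t (interior_subset ht)).differentiableAt.differentiableWithinAt)
    (fun t ht => ?_)
  rw [(h t (interior_subset ht)).deriv]
  exact h0 t (interior_subset ht)

/-- The bound on the second derivative of a self-concordant function of one variable. -/
theorem second_deriv_le_of_selfConcordant {q q' : ℝ → ℝ} {D τ : ℝ}
    (hq : ∀ t, HasDerivAt q (q' t) t) (hpos : ∀ t, 0 < q t)
    (hsc : ∀ t, |q' t| ≤ 2 * q t ^ (3 / 2 : ℝ))
    (hD : 0 < D) (h0 : q 0 ≤ D ^ 2) (hτ0 : 0 ≤ τ) (hτ : τ * D < 1) :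
    q τ ≤ D ^ 2 / (1 - τ * D) ^ 2 := by
  -- By `hsc`, q^(-1/2) has slope at least -1, so adding t makes it nondecreasing.
  have hder : ∀ t, HasDerivAt (fun t => q t ^ (-(1 / 2) : ℝ) + t)
      (q' t * (-(1 / 2)) * q t ^ (-(1 / 2) - 1 : ℝ) + 1) t := fun t =>
    ((hq t).rpow_const (Or.inl (hpos t).ne')).add (hasDerivAt_id t)
  have hmono := monotoneOn_of_hasDerivAt_nonneg (a := 0) (b := τ) (fun t _ => hder t)
    (fun t _ => by
      have h1 := (abs_le.1 (hsc t)).2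
      have h2 : q t ^ (-(1 / 2) - 1 : ℝ) * q t ^ (3 / 2 : ℝ) = 1 := by
        rw [← Real.rpow_add (hpos t)]; norm_num
      have h3 : 0 < q t ^ (-(1 / 2) - 1 : ℝ) := Real.rpow_pos_of_pos (hpos t) _
      nlinarith)
  have h1 := hmono (Set.left_mem_Icc.2 hτ0) (Set.right_mem_Icc.2 hτ0) hτ0
  simp only [add_zero] at h1
  have hsq : ∀ t, q t ^ (-(1 / 2) : ℝ) = (√(q t))⁻¹ := fun t => by
    rw [Real.rpow_neg (hpos t).le, Real.sqrt_eq_rpow]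
  rw [hsq, hsq] at h1
  have hs0 : 0 < √(q 0) := Real.sqrt_pos.2 (hpos 0)
  have hsτ : 0 < √(q τ) := Real.sqrt_pos.2 (hpos τ)
  have h2 : D⁻¹ ≤ (√(q 0))⁻¹ := by
    apply inv_anti₀ hs0
    exact Real.sqrt_le_iff.2 ⟨hD.le, h0⟩
  have h3 : D⁻¹ - τ ≤ (√(q τ))⁻¹ := by linarith
  have h4 : D⁻¹ - τ = (1 - τ * D) / D := by field_simp
  have h5 : 0 < 1 - τ * D := by linarith
  have h6 : √(q τ) ≤ D / (1 - τ * D) := by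
    rw [h4] at h3
    have := inv_anti₀ (div_pos h5 hD) h3
    rwa [inv_inv, inv_div] at this
  calc q τ = √(q τ) ^ 2 := (Real.sq_sqrt (hpos τ).le).symm
    _ ≤ (D / (1 - τ * D)) ^ 2 := by gcongr
    _ = _ := by rw [div_pow]

/-- The upper bound on a self-concordant function of one variable. -/
theorem le_of_selfConcordant {ψ ψ₁ q q' : ℝ → ℝ} {D τ : ℝ}
    (hψ : ∀ t, HasDerivAt ψ (ψ₁ t) t) (hψ₁ : ∀ t, HasDerivAt ψ₁ (q t) t)
    (hq : ∀ t, HasDerivAt q (q' t) t) (hpos : ∀ t, 0 < q t)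
    (hsc : ∀ t, |q' t| ≤ 2 * q t ^ (3 / 2 : ℝ))
    (hD : 0 < D) (h0 : q 0 ≤ D ^ 2) (hτ0 : 0 ≤ τ) (hτ : τ * D < 1) :
    ψ τ ≤ ψ 0 + τ * ψ₁ 0 - τ * D - Real.log (1 - τ * D) := by
  have hlt : ∀ t ∈ Set.Icc 0 τ, t * D < 1 := fun t ht =>
    (mul_le_mul_of_nonneg_right ht.2 hD.le).trans_lt hτ
  have hlin : ∀ t, HasDerivAt (fun t : ℝ => 1 - t * D) (-D) t := fun t => by
    simpa using ((hasDerivAt_id t).mul_const D).const_sub 1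
  -- D/(1 - tD) and -log(1 - tD) are successive antiderivatives of D²/(1 - tD)², so the bound on q
  -- is integrated twice by comparing derivatives.
  have hd1 : ∀ t ∈ Set.Icc 0 τ, HasDerivAt (fun t => D / (1 - t * D) - ψ₁ t)
      (D ^ 2 / (1 - t * D) ^ 2 - q t) t := fun t ht => by
    have hne : 1 - t * D ≠ 0 := by linarith [hlt t ht]
    exact (((hasDerivAt_const t D).div (hlin t) hne).sub (hψ₁ t)).congr_deriv (by ring)
  have hm1 := monotoneOn_of_hasDerivAt_nonneg hd1 (fun t ht => by
    linarith [second_deriv_le_of_selfConcordant hq hpos hsc hD h0 ht.1 (hlt t ht)])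
  have hb1 : ∀ t ∈ Set.Icc 0 τ, ψ₁ t ≤ ψ₁ 0 + (D / (1 - t * D) - D) := fun t ht => by
    have := hm1 (Set.left_mem_Icc.2 hτ0) ht ht.1
    simp only [zero_mul, sub_zero, div_one] at this
    linarith
  have hd2 : ∀ t ∈ Set.Icc 0 τ, HasDerivAt
      (fun t => t * (ψ₁ 0 - D) - Real.log (1 - t * D) - ψ t)
      (ψ₁ 0 - D + D / (1 - t * D) - ψ₁ t) t := fun t ht => by
    have hne : 1 - t * D ≠ 0 := by linarith [hlt t ht]
    exact ((((hasDerivAt_id t).mul_const (ψ₁ 0 - D)).sub ((hlin t).log hne)).sub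
      (hψ t)).congr_deriv (by ring)
  have hm2 := monotoneOn_of_hasDerivAt_nonneg hd2 (fun t ht => by linarith [hb1 t ht])
  have := hm2 (Set.left_mem_Icc.2 hτ0) (Set.right_mem_Icc.2 hτ0) hτ0
  simp only [zero_mul, sub_zero, Real.log_one] at this
  linarith

theorem quadratic_lower_bound {ψ ψ₁ q : ℝ → ℝ} {c : ℝ}
    (hψ : ∀ t, HasDerivAt ψ (ψ₁ t) t) (hψ₁ : ∀ t, HasDerivAt ψ₁ (q t) t)
    (hq : ∀ t, c ≤ q t) : ψ 0 + ψ₁ 0 + c / 2 ≤ ψ 1 := by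
  have hm1 := monotoneOn_of_hasDerivAt_nonneg (a := 0) (b := 1) (φ := fun t => ψ₁ t - t * c)
    (fun t _ => (hψ₁ t).sub ((hasDerivAt_id t).mul_const c)) (fun t _ => by linarith [hq t])
  have hb1 : ∀ t ∈ Set.Icc (0 : ℝ) 1, ψ₁ 0 + t * c ≤ ψ₁ t := fun t ht => by
    have := hm1 (Set.left_mem_Icc.2 zero_le_one) ht ht.1
    simp only [zero_mul, sub_zero] at this
    linarith
  have hm2 := monotoneOn_of_hasDerivAt_nonneg (a := 0) (b := 1)
    (φ := fun t => ψ t - t * ψ₁ 0 - t ^ 2 * (c / 2)) (φ' := fun t => ψ₁ t - ψ₁ 0 - t * c)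
    (fun t _ => (((hψ t).sub ((hasDerivAt_id t).mul_const (ψ₁ 0))).sub
      ((hasDerivAt_pow 2 t).mul_const (c / 2))).congr_deriv (by norm_num; ring)) (fun t ht => by linarith [hb1 t ht])
  have := hm2 (Set.left_mem_Icc.2 zero_le_one) (Set.right_mem_Icc.2 zero_le_one) zero_le_one
  norm_num at this
  linarith

/-- With y = √(1 + η), the estimate log(1 + η) = 2 log y ≤ 2(y - 1) leaves (y - 1)² on the right,
and η² = (y - 1)²(y + 1)² ≤ 4y²(y - 1)². -/
theorem sq_div_le_sub_log {η : ℝ} (hη : 0 ≤ η) :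
    η ^ 2 / (4 * (1 + η)) ≤ η - Real.log (1 + η) := by
  set y := √(1 + η) with hy
  have hy2 : y ^ 2 = 1 + η := Real.sq_sqrt (by linarith)
  have hy1 : 1 ≤ y := by rw [hy]; exact Real.one_le_sqrt.2 (by linarith)
  have hlog : Real.log (1 + η) ≤ 2 * (y - 1) := by
    rw [← hy2, Real.log_pow]
    have := Real.log_le_sub_one_of_pos (x := y) (by linarith)
    push_cast; linarith
  have h1 : η = y ^ 2 - 1 := by linarith
  refine le_trans ?_ (sub_le_sub_left hlog η)
  rw [div_le_iff₀ (by linarith), h1]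
  have : (y ^ 2 - 1) ^ 2 ≤ (y - 1) ^ 2 * (4 * y ^ 2) := by
    have h2 : (y + 1) ^ 2 ≤ 4 * y ^ 2 := by nlinarith
    calc (y ^ 2 - 1) ^ 2 = (y - 1) ^ 2 * (y + 1) ^ 2 := by ring
      _ ≤ _ := mul_le_mul_of_nonneg_left h2 (sq_nonneg _)
  linarith

end OneDimensional

/-! ### Restriction to lines and the deterministic contraction step. -/

section Lines

variable {d : ℕ} {F : EuclideanSpace ℝ (Fin d) → ℝ}

theorem ContDiff.gradient' {n m : WithTop ℕ∞} (hF : ContDiff ℝ n F) (hm : m + 1 ≤ n) :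
    ContDiff ℝ m (gradient F) :=
  (InnerProductSpace.toDual ℝ (EuclideanSpace ℝ (Fin d))).symm.contDiff.comp
    (hF.fderiv_right hm)

theorem hasDerivAt_line (x h : EuclideanSpace ℝ (Fin d)) (t : ℝ) :
    HasDerivAt (fun t : ℝ => x + t • h) h t := by
  simpa using ((hasDerivAt_id t).smul_const h).const_add x

theorem hasDerivAt_comp_line (hF : ContDiff ℝ 2 F) (x h : EuclideanSpace ℝ (Fin d)) (t : ℝ) :
    HasDerivAt (fun t : ℝ => F (x + t • h)) (inner ℝ (gradient F (x + t • h)) h) t := by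
  rw [inner_gradient_left]
  exact ((hF.differentiable (by norm_num)) _).hasFDerivAt.comp_hasDerivAt t (hasDerivAt_line x h t)

theorem hasDerivAt_inner_gradient_line (hF : ContDiff ℝ 2 F) (x h : EuclideanSpace ℝ (Fin d))
    (t : ℝ) :
    HasDerivAt (fun t : ℝ => inner ℝ (gradient F (x + t • h)) h)
      (inner ℝ (hess F (x + t • h) h) h) t := by
  have hd : Differentiable ℝ (gradient F) :=
    (hF.gradient' (m := 1) (by norm_num)).differentiable (by norm_num)
  have h1 := (hd _).hasFDerivAt.comp_hasDerivAt t (hasDerivAt_line x h t)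
  simpa [hess] using h1.inner ℝ (hasDerivAt_const t h)

theorem inner_hess_left (hF : ContDiff ℝ 2 F) (x h : EuclideanSpace ℝ (Fin d)) :
    inner ℝ (hess F x h) h = iteratedFDeriv ℝ 2 F x (fun _ => h) := by
  rw [iteratedFDeriv_two_apply]
  have hd : Differentiable ℝ (fderiv ℝ F) :=
    (hF.fderiv_right (m := 1) (by norm_num)).differentiable (by norm_num)
  have h1 := ((InnerProductSpace.toDual ℝ (EuclideanSpace ℝ (Fin d))).symm.toContinuousLinearEquiv
    |>.toContinuousLinearMap).hasFDerivAt.comp x (hd x).hasFDerivAt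
  have h2 : hess F x = _ := h1.fderiv
  rw [h2]
  simp

theorem hasDerivAt_inner_hess_line (hF : ContDiff ℝ 3 F) (x h : EuclideanSpace ℝ (Fin d))
    (t : ℝ) :
    HasDerivAt (fun t : ℝ => inner ℝ (hess F (x + t • h) h) h)
      (iteratedFDeriv ℝ 3 F (x + t • h) (fun _ => h)) t := by
  have hF2 : ContDiff ℝ 2 F := hF.of_le (by norm_num)
  simp only [inner_hess_left hF2]
  have hd : Differentiable ℝ (iteratedFDeriv ℝ 2 F) :=
    hF.differentiable_iteratedFDeriv (m := 2) (by norm_num)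
  have h1 := (hd (x + t • h)).hasFDerivAt.comp_hasDerivAt t (hasDerivAt_line x h t)
  rw [iteratedFDeriv_succ_apply_left]
  exact (ContinuousMultilinearMap.apply ℝ (fun _ : Fin 2 => EuclideanSpace ℝ (Fin d)) ℝ
    (fun _ => h)).hasFDerivAt.comp_hasDerivAt t h1

theorem le_inner_of_smul_one_le {T : EuclideanSpace ℝ (Fin d) →L[ℝ] EuclideanSpace ℝ (Fin d)}
    {m : ℝ} (h : m • (1 : EuclideanSpace ℝ (Fin d) →L[ℝ] EuclideanSpace ℝ (Fin d)) ≤ T)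
    (v : EuclideanSpace ℝ (Fin d)) : m * ‖v‖ ^ 2 ≤ inner ℝ (T v) v := by
  have := ((ContinuousLinearMap.le_def _ _).1 h).inner_nonneg_left v
  simp [inner_sub_left, inner_smul_left] at this
  linarith

theorem inner_le_of_le_smul_one {T : EuclideanSpace ℝ (Fin d) →L[ℝ] EuclideanSpace ℝ (Fin d)}
    {m : ℝ} (h : T ≤ m • (1 : EuclideanSpace ℝ (Fin d) →L[ℝ] EuclideanSpace ℝ (Fin d)))
    (v : EuclideanSpace ℝ (Fin d)) : inner ℝ (T v) v ≤ m * ‖v‖ ^ 2 := by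
  have := ((ContinuousLinearMap.le_def _ _).1 h).inner_nonneg_left v
  simp [inner_sub_left, inner_smul_left] at this
  linarith

theorem inner_nonneg_of_nonneg {T : EuclideanSpace ℝ (Fin d) →L[ℝ] EuclideanSpace ℝ (Fin d)}
    (h : 0 ≤ T) (v : EuclideanSpace ℝ (Fin d)) : 0 ≤ inner ℝ (T v) v :=
  ((ContinuousLinearMap.nonneg_iff_isPositive T).1 h).inner_nonneg_left v

/-- The Polyak–Łojasiewicz inequality for strongly convex functions. -/
theorem sub_le_norm_gradient_sq {m : ℝ} (hF : ContDiff ℝ 2 F) (hm : 0 < m)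
    (hess_ge : ∀ x, m • (1 : EuclideanSpace ℝ (Fin d) →L[ℝ] EuclideanSpace ℝ (Fin d)) ≤ hess F x)
    (x y : EuclideanSpace ℝ (Fin d)) :
    2 * m * (F x - F y) ≤ ‖gradient F x‖ ^ 2 := by
  have h := quadratic_lower_bound (hasDerivAt_comp_line hF x (y - x))
    (hasDerivAt_inner_gradient_line hF x (y - x))
    (fun t => le_inner_of_smul_one_le (hess_ge (x + t • (y - x))) (y - x))
  simp only [zero_smul, add_zero, one_smul, add_sub_cancel] at h
  -- Completing the square: the quadratic minorant, as a function of y, is minimal where this vector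
  -- vanishes.
  have h1 : 0 ≤ ‖gradient F x + m • (y - x)‖ ^ 2 := sq_nonneg _
  rw [norm_add_sq_real, inner_smul_right, norm_smul, mul_pow, Real.norm_eq_abs, sq_abs] at h1
  nlinarith

/-- D need only dominate the local norm of g, so a sampled overestimate is admissible. Strong
convexity and g ≠ 0 keep the second derivative along the line positive, as the power -1/2 requires.
-/
theorem selfConcordant_descent {m D t : ℝ} (hF : SelfConcordant 2 F) (hm : 0 < m)
    (hess_ge : ∀ x, m • (1 : EuclideanSpace ℝ (Fin d) →L[ℝ] EuclideanSpace ℝ (Fin d)) ≤ hess F x)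
    {x g : EuclideanSpace ℝ (Fin d)} (hg : g ≠ 0) (hD : 0 < D)
    (hgD : inner ℝ (hess F x g) g ≤ D ^ 2) (ht : 0 ≤ t) (htD : t * D < 1) :
    F (x - t • g) ≤ F x - t * inner ℝ (gradient F x) g - t * D - Real.log (1 - t * D) := by
  have hF2 : ContDiff ℝ 2 F := hF.smooth.of_le (by norm_num)
  have hng : 0 < ‖-g‖ := norm_pos_iff.2 (neg_ne_zero.2 hg)
  have h := le_of_selfConcordant (D := D) (hasDerivAt_comp_line hF2 x (-g))
    (hasDerivAt_inner_gradient_line hF2 x (-g)) (hasDerivAt_inner_hess_line hF.smooth x (-g))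
    (fun t => lt_of_lt_of_le (by positivity)
      (le_inner_of_smul_one_le (hess_ge (x + t • (-g))) (-g)))
    (fun t => by
      rw [inner_hess_left hF2]
      exact hF.bound _ _) hD (by simpa using hgD) ht htD
  simp only [zero_smul, sub_zero, smul_neg, inner_neg_right, ← sub_eq_add_neg] at h
  linarith

/-- One step along an approximate gradient `g` with the step size computed from an estimate `D` of
the local norm of `g` contracts the error. -/
theorem contraction_step {m M γ ν ε D : ℝ} (hF : SelfConcordant 2 F) (hm : 0 < m) (hmM : m ≤ M)
    (hess_ge : ∀ x, m • (1 : EuclideanSpace ℝ (Fin d) →L[ℝ] EuclideanSpace ℝ (Fin d)) ≤ hess F x)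
    {xstar : EuclideanSpace ℝ (Fin d)} (hxstar : ∀ y, F xstar ≤ F y)
    (hγ : 0 < γ) (hν0 : 0 < ν) (hν1 : ν < 1) (hε1 : ε < 1)
    {x g : EuclideanSpace ℝ (Fin d)} (hgrad : ‖g - gradient F x‖ ≤ ν * ‖g‖)
    (hxγ : ‖gradient F x‖ ≤ γ) (hD : 0 ≤ D) (hgD : inner ℝ (hess F x g) g ≤ D ^ 2)
    (hDM : D ^ 2 * (1 - ε) ≤ M * ‖g‖ ^ 2) :
    F (x - (inner ℝ g (gradient F x) / ((inner ℝ g (gradient F x) + D) * D)) • g) - F xstar ≤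
      contractionFactor m M γ ν ε * (F x - F xstar) := by
  have hF2 : ContDiff ℝ 2 F := hF.smooth.of_le (by norm_num)
  have hPL := sub_le_norm_gradient_sq hF2 hm hess_ge x xstar
  have hgap : 0 ≤ F x - F xstar := sub_nonneg.2 (hxstar x)
  by_cases hg : g = 0
  · subst hg
    have hv : ‖gradient F x‖ = 0 := by
      have : ‖gradient F x‖ ≤ 0 := by simpa using hgrad
      exact le_antisymm this (norm_nonneg _)
    rw [hv] at hPL
    have : F x - F xstar = 0 := by nlinarith
    simp [this]
  have hng : 0 < ‖g‖ := norm_pos_iff.2 hg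
  set v := gradient F x with hv
  set ρ : ℝ := inner ℝ g v with hρ
  have hmg := le_inner_of_smul_one_le (hess_ge x) g
  have hD2 : m * ‖g‖ ^ 2 ≤ D ^ 2 := hmg.trans hgD
  have hDpos : 0 < D := lt_of_le_of_ne hD (fun h => by
    rw [← h] at hD2
    have : 0 < m * ‖g‖ ^ 2 := by positivity
    linarith)
  have hexp : ‖g - v‖ ^ 2 ≤ ν ^ 2 * ‖g‖ ^ 2 := by
    rw [← mul_pow]; gcongr
  rw [norm_sub_sq_real] at hexp
  have h1ν : 0 < 1 - ν ^ 2 := by nlinarith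
  have h2ρ : (1 - ν ^ 2) * ‖g‖ ^ 2 + ‖v‖ ^ 2 ≤ 2 * ρ := by linarith
  have hρpos : 0 < ρ := by
    have : 0 < (1 - ν ^ 2) * ‖g‖ ^ 2 := by positivity
    nlinarith [sq_nonneg ‖v‖]
  -- AM–GM applied to the two summands of `h2ρ`.
  have hρsq : (1 - ν ^ 2) * ‖g‖ ^ 2 * ‖v‖ ^ 2 ≤ ρ ^ 2 := by
    have h3 : ((1 - ν ^ 2) * ‖g‖ ^ 2 + ‖v‖ ^ 2) ^ 2 ≤ (2 * ρ) ^ 2 := by gcongr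
    nlinarith [sq_nonneg ((1 - ν ^ 2) * ‖g‖ ^ 2 - ‖v‖ ^ 2)]
  set η := ρ / D with hη
  have hηpos : 0 < η := div_pos hρpos hDpos
  -- This t minimizes -tρ - tD - log(1 - tD); there 1 - tD = 1/(1 + η).
  set t := ρ / ((ρ + D) * D) with ht
  have htpos : 0 < t := by positivity
  have htD : t * D = η / (1 + η) := by
    rw [ht, hη]; field_simp; ring
  have htρ : t * ρ = η ^ 2 / (1 + η) := by
    rw [ht, hη]; field_simp; ring
  have h1η : 1 - t * D = (1 + η)⁻¹ := by rw [htD]; field_simp; ring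
  have hdesc := selfConcordant_descent hF hm hess_ge hg hDpos hgD htpos.le (by
    have : 0 < (1 + η)⁻¹ := by positivity
    linarith)
  rw [h1η, Real.log_inv, real_inner_comm, ← hv, ← hρ, htρ, htD] at hdesc
  have hdec : η ^ 2 / (4 * (1 + η)) ≤ F x - F (x - t • g) := by
    have h4 := sq_div_le_sub_log hηpos.le
    have h5 : η ^ 2 / (1 + η) + η / (1 + η) = η := by field_simp; ring
    linarith
  have hη2 : (1 - ν ^ 2) * (1 - ε) * ‖v‖ ^ 2 / M ≤ η ^ 2 := by
    rw [hη, div_pow, div_le_div_iff₀ (by linarith) (by positivity)]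
    calc (1 - ν ^ 2) * (1 - ε) * ‖v‖ ^ 2 * D ^ 2
        = (1 - ν ^ 2) * ‖v‖ ^ 2 * (D ^ 2 * (1 - ε)) := by ring
      _ ≤ (1 - ν ^ 2) * ‖v‖ ^ 2 * (M * ‖g‖ ^ 2) := by gcongr
      _ = (1 - ν ^ 2) * ‖g‖ ^ 2 * ‖v‖ ^ 2 * M := by ring
      _ ≤ ρ ^ 2 * M := by
        have : 0 ≤ M := by linarith
        gcongr
  have hsm : 0 < √m := Real.sqrt_pos.2 hm
  have hηγ : η ≤ γ / √m := by
    rw [hη, div_le_div_iff₀ hDpos hsm]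
    have h6 : √m * ‖g‖ ≤ D := by
      apply abs_le_of_sq_le_sq' _ hD |>.2
      rwa [mul_pow, Real.sq_sqrt hm.le]
    calc ρ * √m ≤ ‖g‖ * ‖v‖ * √m := by gcongr; exact real_inner_le_norm g v
      _ = ‖v‖ * (√m * ‖g‖) := by ring
      _ ≤ γ * D := by gcongr
  set Γ := γ / √m with hΓ
  have hΓpos : 0 < Γ := by positivity
  have hMpos : 0 < M := by linarith
  have h1ε : 0 < 1 - ε := by linarith
  -- The estimates yield the factor 1 - ν², which is at least (1 - ν)²/(1 + ν²). The numerator uses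
  -- the lower bound on η², the denominator the upper bound η ≤ Γ.
  have hfin : m * (1 - ν) ^ 2 * (1 - ε) / (2 * (1 + ν ^ 2) * M * (1 + Γ)) * (F x - F xstar) ≤
      η ^ 2 / (4 * (1 + η)) := by
    calc m * (1 - ν) ^ 2 * (1 - ε) / (2 * (1 + ν ^ 2) * M * (1 + Γ)) * (F x - F xstar)
        = ((1 - ν) ^ 2 / (1 + ν ^ 2)) * ((1 - ε) / (4 * M * (1 + Γ)) *
            (2 * m * (F x - F xstar))) := by field_simp; ring
      _ ≤ (1 - ν ^ 2) * ((1 - ε) / (4 * M * (1 + Γ)) * ‖v‖ ^ 2) := by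
        gcongr
        rw [div_le_iff₀ (by positivity)]
        nlinarith [mul_pos h1ν (sq_pos_of_pos hν0)]
      _ = (1 - ν ^ 2) * (1 - ε) * ‖v‖ ^ 2 / M / (4 * (1 + Γ)) := by field_simp
      _ ≤ η ^ 2 / (4 * (1 + η)) := by gcongr
  unfold contractionFactor
  rw [← hΓ, sub_mul, one_mul]
  linarith

end Lines

/-! ### Hoeffding inequalities for uniform draws, for vectors and for scalars. -/

section Concentration

variable {N : ℕ} {Ω : Type*} [MeasurableSpace Ω] {μ : Measure Ω}

theorem measureReal_preimage_uniform {X : Ω → Fin N} (hX : Measurable X)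
    (hu : μ.map X = uniformOn Set.univ) (a : Fin N) : μ.real (X ⁻¹' {a}) = 1 / (N : ℝ) := by
  rw [← map_measureReal_apply hX (measurableSet_singleton a), hu, Measure.real, uniformOn_univ]
  simp

theorem integral_comp_uniform [IsProbabilityMeasure μ] {X : Ω → Fin N} (hX : Measurable X)
    (hu : μ.map X = uniformOn Set.univ) (h : Fin N → ℝ) :
    ∫ ω, h (X ω) ∂μ = (1 / (N : ℝ)) * ∑ a, h a := by
  have := Measure.isProbabilityMeasure_map (μ := μ) hX.aemeasurable
  rw [← integral_map hX.aemeasurable (by fun_prop),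
    integral_fintype (Integrable.of_finite), Finset.mul_sum]
  refine Finset.sum_congr rfl fun a _ => ?_
  rw [map_measureReal_apply hX (measurableSet_singleton a), measureReal_preimage_uniform hX hu,
    smul_eq_mul]

variable {E : Type*} [NormedAddCommGroup E]

/-- The mean of `φ (w + u a)` over a uniformly distributed index `a`. -/
noncomputable def stepMean (u : Fin N → E) (φ : E → ℝ) (w : E) : ℝ :=
  (1 / (N : ℝ)) * ∑ a, φ (w + u a)

/-- Replaces conditional expectations by a deterministic averaging operator, so that the martingale
argument becomes induction on n. The last draw is peeled off by splitting over its value;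
independence factors each term. -/
theorem integral_comp_sum_uniform [IsProbabilityMeasure μ] {ξ : ℕ → Ω → Fin N}
    (hξ : ∀ j, Measurable (ξ j)) (hu : ∀ j, μ.map (ξ j) = uniformOn Set.univ)
    (hind : iIndepFun ξ μ) (u : Fin N → E) (φ : E → ℝ) (n : ℕ) (w : E) :
    ∫ ω, φ (w + ∑ j ∈ Finset.range n, u (ξ j ω)) ∂μ = (stepMean u)^[n] φ w := by
  induction n generalizing w with
  | zero => simp
  | succ n ih =>
    rw [Function.iterate_succ_apply', stepMean]
    let V : Ω → (Finset.range n → Fin N) := fun ω j => ξ j ω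
    have hV : Measurable V := measurable_pi_lambda _ fun j => hξ j
    let Φ : Fin N → (Finset.range n → Fin N) → ℝ := fun a v =>
      φ (w + u a + ∑ j : Finset.range n, u (v j))
    have hΦ : ∀ a ω, Φ a (V ω) = φ (w + u a + ∑ j ∈ Finset.range n, u (ξ j ω)) := fun a ω => by
      simp only [Φ, V]
      rw [Finset.sum_coe_sort (Finset.range n) (fun j => u (ξ j ω))]
    let W : Fin N → (({n} : Finset ℕ) → Fin N) → ℝ := fun a v =>
      if v ⟨n, by simp⟩ = a then 1 else 0
    have hindep : IndepFun V (fun ω (j : ({n} : Finset ℕ)) => ξ j ω) μ :=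
      hind.indepFun_finset (Finset.range n) {n} (by simp) hξ
    have hsplit : ∀ ω, φ (w + ∑ j ∈ Finset.range (n + 1), u (ξ j ω)) =
        ∑ a, Φ a (V ω) * W a (fun j => ξ j ω) := fun ω => by
      rw [Finset.sum_eq_single (ξ n ω)]
      · simp only [hΦ, W, if_true, mul_one, Finset.sum_range_succ]
        congr 1; abel
      · intro b _ hb
        simp [W, hb.symm]
      · simp
    have hint : ∀ a, Integrable (fun ω => Φ a (V ω) * W a (fun j => ξ j ω)) μ := fun a => by
      have : Integrable (fun q : (Finset.range n → Fin N) × (({n} : Finset ℕ) → Fin N) =>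
          Φ a q.1 * W a q.2) (μ.map fun ω => (V ω, fun j : ({n} : Finset ℕ) => ξ j ω)) :=
        Integrable.of_finite
      exact this.comp_measurable (hV.prodMk (measurable_pi_lambda _ fun j => hξ j))
    simp_rw [hsplit]
    rw [integral_finsetSum _ fun a _ => hint a, Finset.mul_sum]
    refine Finset.sum_congr rfl fun a _ => ?_
    have h1 := (hindep.comp (φ := Φ a) (ψ := W a) (by fun_prop)
      (by fun_prop)).integral_mul_eq_mul_integral
      (Measurable.aestronglyMeasurable (by fun_prop))
      (Measurable.aestronglyMeasurable
        ((measurable_of_finite (W a)).comp (measurable_pi_lambda _ fun j => hξ j)))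
    refine h1.trans ?_
    have h2 : ∫ ω, (Φ a ∘ V) ω ∂μ = (stepMean u)^[n] φ (w + u a) := by
      rw [← ih]
      exact integral_congr_ae (Filter.Eventually.of_forall fun ω => hΦ a ω)
    have h3 : ∫ ω, (W a ∘ fun ω (j : ({n} : Finset ℕ)) => ξ j ω) ω ∂μ = 1 / (N : ℝ) := by
      have := integral_comp_uniform (hξ n) (hu n) (fun b => if b = a then 1 else 0)
      simpa [W] using this
    rw [h2, h3, mul_comm]

/-- Cauchy–Schwarz moves the average under the root, and the cross terms cancel because the steps
sum to zero; each draw thus adds at most V, whatever the dimension. -/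
theorem iterate_stepMean_norm_le [InnerProductSpace ℝ E] {u : Fin N → E} {V : ℝ} (hN : 0 < N) (hu0 : ∑ a, u a = 0)
    (hV0 : 0 ≤ V) (hV : (1 / (N : ℝ)) * ∑ a, ‖u a‖ ^ 2 ≤ V) (n : ℕ) (w : E) :
    (stepMean u)^[n] norm w ≤ √(‖w‖ ^ 2 + n * V) := by
  have hN' : (0 : ℝ) < N := Nat.cast_pos.2 hN
  induction n generalizing w with
  | zero => simp
  | succ n ih =>
    rw [Function.iterate_succ_apply', stepMean]
    apply Real.le_sqrt_of_sq_le
    have h1 : ∑ a, (stepMean u)^[n] norm (w + u a) ≤ ∑ a, √(‖w + u a‖ ^ 2 + n * V) :=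
      Finset.sum_le_sum fun a _ => ih _
    have h0 : 0 ≤ ∑ a, (stepMean u)^[n] norm (w + u a) := Finset.sum_nonneg fun a _ => by
      clear ih h1
      generalize w + u a = z
      induction n generalizing z with
      | zero => simp
      | succ n ih =>
        rw [Function.iterate_succ_apply', stepMean]
        exact mul_nonneg (by positivity) (Finset.sum_nonneg fun a _ => ih _)
    have h2 : (∑ a, √(‖w + u a‖ ^ 2 + n * V)) ^ 2 ≤ N * ∑ a, (‖w + u a‖ ^ 2 + n * V) := by
      have := sq_sum_le_card_mul_sum_sq (s := Finset.univ)
        (f := fun a => √(‖w + u a‖ ^ 2 + n * V))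
      simp only [Finset.card_univ, Fintype.card_fin] at this
      refine this.trans_eq ?_
      congr 1
      refine Finset.sum_congr rfl fun a _ => Real.sq_sqrt (by positivity)
    have h3 : ∑ a, (‖w + u a‖ ^ 2 + n * V) = N * ‖w‖ ^ 2 + ∑ a, ‖u a‖ ^ 2 + N * (n * V) := by
      simp_rw [norm_add_sq_real]
      rw [Finset.sum_add_distrib, Finset.sum_add_distrib, Finset.sum_add_distrib,
        ← Finset.mul_sum, ← inner_sum, hu0]
      simp
    have h4 : ∑ a, ‖u a‖ ^ 2 ≤ N * V := by
      rw [one_div, inv_mul_le_iff₀ hN'] at hV; exact hV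
    calc ((1 / (N : ℝ)) * ∑ a, (stepMean u)^[n] norm (w + u a)) ^ 2
        ≤ ((1 / (N : ℝ)) * ∑ a, √(‖w + u a‖ ^ 2 + n * V)) ^ 2 := by gcongr
      _ = (1 / (N : ℝ)) ^ 2 * (∑ a, √(‖w + u a‖ ^ 2 + n * V)) ^ 2 := mul_pow _ _ _
      _ ≤ (1 / (N : ℝ)) ^ 2 * (N * (N * ‖w‖ ^ 2 + N * V + N * (n * V))) := by
        refine mul_le_mul_of_nonneg_left (h2.trans ?_) (by positivity)
        rw [h3]
        gcongr
      _ = ‖w‖ ^ 2 + ((n + 1 : ℕ) : ℝ) * V := by push_cast; field_simp; ring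

/-- Averaging over translates preserves the Lipschitz constant 1 of the norm. This bounds the
influence of a single draw. -/
theorem iterate_stepMean_norm_sub_le (u : Fin N → E) (hN : 0 < N) (n : ℕ) (w z : E) :
    (stepMean u)^[n] norm w - (stepMean u)^[n] norm z ≤ ‖w - z‖ := by
  have hN' : (0 : ℝ) < N := Nat.cast_pos.2 hN
  induction n generalizing w z with
  | zero => exact norm_sub_norm_le w z
  | succ n ih =>
    rw [Function.iterate_succ_apply', stepMean, stepMean, ← mul_sub, ← Finset.sum_sub_distrib,
      one_div, inv_mul_le_iff₀ hN']
    refine (Finset.sum_le_sum fun a _ => ih (w + u a) (z + u a)).trans_eq ?_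
    simp

/-- Hoeffding's lemma for a uniform distribution on `N` points. -/
theorem mean_exp_le_of_diff_le [IsProbabilityMeasure μ] {X : Ω → Fin N} (hX : Measurable X)
    (hu : μ.map X = uniformOn Set.univ) {h : Fin N → ℝ} {c : ℝ}
    (hc : ∀ a b, h a - h b ≤ c) (l : ℝ) :
    (1 / (N : ℝ)) * ∑ a, Real.exp (l * h a) ≤
      Real.exp (l * ((1 / (N : ℝ)) * ∑ a, h a)) * Real.exp (l ^ 2 * c ^ 2 / 8) := by
  have ⟨ω₀⟩ : Nonempty Ω := nonempty_of_isProbabilityMeasure μ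
  have : Nonempty (Fin N) := ⟨X ω₀⟩
  obtain ⟨a₀, ha₀⟩ := Finite.exists_min h
  have hsub := hasSubgaussianMGF_of_mem_Icc (μ := μ) (X := fun ω => h (X ω)) (a := h a₀)
    (b := h a₀ + c) ((measurable_of_finite h).comp hX).aemeasurable
    (Filter.Eventually.of_forall fun ω => ⟨ha₀ _, by linarith [hc (X ω) a₀]⟩)
  have h1 := hsub.mgf_le l
  rw [mgf, integral_comp_uniform hX hu h,
    integral_comp_uniform hX hu (fun a => Real.exp (l * (h a - (1 / (N : ℝ)) * ∑ a, h a)))] at h1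
  simp only [mul_sub, Real.exp_sub] at h1
  rw [← Finset.sum_div, ← mul_div_assoc, div_le_iff₀ (Real.exp_pos _), mul_comm (Real.exp _)] at h1
  refine h1.trans_eq ?_
  congr 2
  simp only [add_sub_cancel_left, NNReal.coe_pow, NNReal.coe_div, coe_nnnorm, Real.norm_eq_abs,
    div_pow, sq_abs, NNReal.coe_ofNat]
  ring

/-- The bounded-differences method: the conditional mean of the norm varies by at most c with each
draw, so Hoeffding's lemma costs a factor exp(l²c²/8) per draw. -/
theorem iterate_stepMean_exp_norm_le [IsProbabilityMeasure μ] {X : Ω → Fin N} (hN : 0 < N)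
    (hX : Measurable X) (hXu : μ.map X = uniformOn Set.univ) {u : Fin N → E} {c : ℝ}
    (hc : ∀ a b, ‖u a - u b‖ ≤ c) (l : ℝ) (n : ℕ) (w : E) :
    (stepMean u)^[n] (fun z => Real.exp (l * ‖z‖)) w ≤
      Real.exp (l * (stepMean u)^[n] norm w) * Real.exp (n * (l ^ 2 * c ^ 2 / 8)) := by
  induction n generalizing w with
  | zero => simp
  | succ n ih =>
    rw [Function.iterate_succ_apply', stepMean]
    calc (1 / (N : ℝ)) * ∑ a, (stepMean u)^[n] (fun z => Real.exp (l * ‖z‖)) (w + u a)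
        ≤ (1 / (N : ℝ)) * ∑ a, Real.exp (l * (stepMean u)^[n] norm (w + u a)) *
            Real.exp (n * (l ^ 2 * c ^ 2 / 8)) := by
          gcongr with a
          exact ih _
      _ = ((1 / (N : ℝ)) * ∑ a, Real.exp (l * (stepMean u)^[n] norm (w + u a))) *
            Real.exp (n * (l ^ 2 * c ^ 2 / 8)) := by rw [← Finset.sum_mul, mul_assoc]
      _ ≤ (Real.exp (l * ((1 / (N : ℝ)) * ∑ a, (stepMean u)^[n] norm (w + u a))) *
            Real.exp (l ^ 2 * c ^ 2 / 8)) * Real.exp (n * (l ^ 2 * c ^ 2 / 8)) := by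
          refine mul_le_mul_of_nonneg_right
            (mean_exp_le_of_diff_le hX hXu (fun a b => ?_) l) (Real.exp_pos _).le
          refine (iterate_stepMean_norm_sub_le u hN n _ _).trans ?_
          simpa using hc a b
      _ = _ := by
          rw [Function.iterate_succ_apply', stepMean, mul_assoc, ← Real.exp_add]
          congr 2
          push_cast; ring

/-- A dimension-free Hoeffding inequality for sums of uniformly drawn centred vectors. -/
theorem measureReal_norm_sum_gt_le [InnerProductSpace ℝ E] [IsProbabilityMeasure μ]
    {ξ : ℕ → Ω → Fin N} (hN : 0 < N)
    (hξ : ∀ j, Measurable (ξ j)) (hu : ∀ j, μ.map (ξ j) = uniformOn Set.univ)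
    (hind : iIndepFun ξ μ) {v : Fin N → E} {G : ℝ} (hv : ∀ a, ‖v a‖ ≤ G) {δ : ℝ} (hδ0 : 0 < δ)
    (hδ1 : δ < 1) (n : ℕ) :
    μ.real {ω | √n * (G * (1 + √(8 * Real.log (1 / δ)))) <
      ‖∑ j ∈ Finset.range n, (v (ξ j ω) - (1 / (N : ℝ)) • ∑ a, v a)‖} ≤ δ := by
  have hN' : (0 : ℝ) < N := Nat.cast_pos.2 hN
  have hG : 0 ≤ G := (norm_nonneg _).trans (hv ⟨0, hN⟩)
  set L := Real.log (1 / δ) with hL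
  have hLpos : 0 < L := Real.log_pos (by rw [one_div]; exact (one_lt_inv₀ hδ0).2 hδ1)
  set vm := (1 / (N : ℝ)) • ∑ a, v a with hvm
  set u : Fin N → E := fun a => v a - vm with hudef
  have hNvm : ∑ a, v a = (N : ℝ) • vm := by
    rw [hvm, smul_smul, mul_one_div_cancel hN'.ne', one_smul]
  have hu0 : ∑ a, u a = 0 := by
    simp [hudef, Finset.sum_sub_distrib, hNvm, Nat.cast_smul_eq_nsmul]
  have hvar : (1 / (N : ℝ)) * ∑ a, ‖u a‖ ^ 2 ≤ G ^ 2 := by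
    rw [one_div, inv_mul_le_iff₀ hN']
    have h1 : ∑ a, ‖u a‖ ^ 2 = ∑ a, ‖v a‖ ^ 2 - N * ‖vm‖ ^ 2 := by
      simp_rw [hudef, norm_sub_sq_real]
      rw [Finset.sum_add_distrib, Finset.sum_sub_distrib, ← Finset.mul_sum, ← sum_inner, hNvm,
        inner_smul_left]
      simp
      ring
    have h2 : ∑ a, ‖v a‖ ^ 2 ≤ ∑ _a : Fin N, G ^ 2 :=
      Finset.sum_le_sum fun a _ => by have := hv a; gcongr
    simp only [Finset.sum_const, Finset.card_univ, Fintype.card_fin, nsmul_eq_mul] at h2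
    have h3 : 0 ≤ N * ‖vm‖ ^ 2 := by positivity
    linarith
  have hdiff : ∀ a b, ‖u a - u b‖ ≤ 2 * G := fun a b => by
    have : u a - u b = v a - v b := by simp [hudef]
    rw [this]
    linarith [norm_sub_le (v a) (v b), hv a, hv b]
  -- In this degenerate case all sums vanish; otherwise R = √n G may be divided by below.
  by_cases hz : √n * G = 0
  · have hS : ∀ ω, ‖∑ j ∈ Finset.range n, u (ξ j ω)‖ = 0 := fun ω => by
      rcases mul_eq_zero.1 hz with h | h
      · have : n = 0 := by
          rw [Real.sqrt_eq_zero (Nat.cast_nonneg n)] at h; exact_mod_cast h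
        simp [this]
      · have hv0 : ∀ a, v a = 0 := fun a => norm_le_zero_iff.1 (h ▸ hv a)
        simp [hudef, hvm, hv0]
    have he : {ω | √n * (G * (1 + √(8 * L))) < ‖∑ j ∈ Finset.range n, u (ξ j ω)‖} = ∅ := by
      ext ω
      simp [hS, ← mul_assoc, hz]
    simp only [hudef] at he
    rw [he]; simpa using hδ0.le
  have hpos : 0 < √n * G := lt_of_le_of_ne (by positivity) (Ne.symm hz)
  set R := √n * G with hR
  -- Minimizes the Chernoff exponent -lR√(8L) + l²R²/2. The resulting bound is exp(-4L) = δ⁴, below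
  -- the required δ.
  set l := √(8 * L) / R with hl
  have hlpos : 0 ≤ l := by positivity
  have hmgf := (integral_comp_sum_uniform hξ hu hind u (fun z => Real.exp (l * ‖z‖)) n 0).trans_le
    (iterate_stepMean_exp_norm_le hN (hξ 0) (hu 0) hdiff l n 0)
  simp only [zero_add] at hmgf
  have hmean := iterate_stepMean_norm_le hN hu0 (sq_nonneg G) hvar n 0
  rw [norm_zero, zero_pow two_ne_zero, zero_add, Real.sqrt_mul (Nat.cast_nonneg n),
    Real.sqrt_sq hG, ← hR] at hmean
  have hint : Integrable (fun ω => Real.exp (l * ‖∑ j ∈ Finset.range n, u (ξ j ω)‖)) μ := by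
    let Φ : (Fin n → Fin N) → ℝ := fun q => Real.exp (l * ‖∑ j, u (q j)‖)
    have h1 : Integrable Φ (μ.map fun ω (j : Fin n) => ξ j ω) := Integrable.of_finite
    have h2 := h1.comp_measurable (measurable_pi_lambda _ fun j => hξ j)
    refine h2.congr (Filter.Eventually.of_forall fun ω => ?_)
    simp only [Φ, Function.comp]
    rw [Fin.sum_univ_eq_sum_range (fun j => u (ξ j ω)) n]
  have hch := measure_ge_le_exp_mul_mgf (μ := μ)
    (X := fun ω => ‖∑ j ∈ Finset.range n, u (ξ j ω)‖) (R * (1 + √(8 * L))) hlpos hint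
  have hlR : l * R = √(8 * L) := by rw [hl]; field_simp
  have hn : (n : ℝ) * (l ^ 2 * (2 * G) ^ 2 / 8) = 4 * L := by
    have h1 : (n : ℝ) * G ^ 2 = R ^ 2 := by
      rw [hR, mul_pow, Real.sq_sqrt (Nat.cast_nonneg n)]
    calc (n : ℝ) * (l ^ 2 * (2 * G) ^ 2 / 8) = l ^ 2 * (n * G ^ 2) / 2 := by ring
      _ = (l * R) ^ 2 / 2 := by rw [h1]; ring
      _ = 4 * L := by rw [hlR, Real.sq_sqrt (by positivity)]; ring
  calc μ.real {ω | √n * (G * (1 + √(8 * L))) < ‖∑ j ∈ Finset.range n, u (ξ j ω)‖}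
      ≤ μ.real {ω | R * (1 + √(8 * L)) ≤ ‖∑ j ∈ Finset.range n, u (ξ j ω)‖} := by
        refine measureReal_mono fun ω hω => ?_
        simp only [Set.mem_ofPred_eq] at hω ⊢
        rw [hR, mul_assoc]; exact hω.le
    _ ≤ Real.exp (-l * (R * (1 + √(8 * L)))) * (Real.exp (l * R) * Real.exp (4 * L)) := by
        refine hch.trans (mul_le_mul_of_nonneg_left (hmgf.trans ?_) (Real.exp_pos _).le)
        rw [hn]
        gcongr
    _ = Real.exp (-(4 * L)) := by
        rw [← Real.exp_add, ← Real.exp_add]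
        congr 1
        have h5 : -l * (R * (1 + √(8 * L))) = -(l * R) - l * R * √(8 * L) := by ring
        rw [h5, hlR, Real.mul_self_sqrt (by positivity)]
        ring
    _ ≤ Real.exp (-L) := Real.exp_le_exp.2 (by linarith)
    _ = δ := by rw [hL, one_div, Real.log_inv, neg_neg, Real.exp_log hδ0]

/-- The lower tail of the mean of a uniform sample of numbers in `[0, b]`. -/
theorem measureReal_sum_lt_le [IsProbabilityMeasure μ] {ζ : ℕ → Ω → Fin N}
    (hζ : ∀ j, Measurable (ζ j)) (hu : ∀ j, μ.map (ζ j) = uniformOn Set.univ)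
    (hind : iIndepFun ζ μ) {q : Fin N → ℝ} {b t : ℝ} (hq0 : ∀ a, 0 ≤ q a) (hqb : ∀ a, q a ≤ b)
    (ht : 0 ≤ t) (n : ℕ) :
    μ.real {ω | ∑ j ∈ Finset.range n, q (ζ j ω) < n * ((1 / (N : ℝ)) * ∑ a, q a) - n * t} ≤
      Real.exp (-(2 * n * t ^ 2 / b ^ 2)) := by
  set qm := (1 / (N : ℝ)) * ∑ a, q a with hqm
  let Y : ℕ → Ω → ℝ := fun j ω => (-q (ζ j ω)) - ∫ ω, (-q (ζ j ω)) ∂μ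
  have hY : ∀ j ω, Y j ω = qm - q (ζ j ω) := fun j ω => by
    simp only [Y]
    rw [integral_neg, integral_comp_uniform (hζ j) (hu j) q]
    ring
  have hYind : iIndepFun Y μ := by
    have : Y = fun j => (fun a => qm - q a) ∘ ζ j := by
      funext j ω; exact hY j ω
    rw [this]
    exact hind.comp (fun _ a => qm - q a) fun j => measurable_of_finite _
  have hsub : ∀ j < n, HasSubgaussianMGF (Y j) ((‖(0 : ℝ) - (-b)‖₊ / 2) ^ 2) μ := fun j _ =>
    hasSubgaussianMGF_of_mem_Icc
      ((measurable_of_finite (fun a => -q a)).comp (hζ j)).aemeasurable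
      (Filter.Eventually.of_forall fun ω =>
        ⟨neg_le_neg (hqb _), by simpa using hq0 (ζ j ω)⟩)
  have h := HasSubgaussianMGF.measure_sum_range_ge_le_of_iIndepFun hYind hsub
    (ε := n * t) (by positivity)
  refine (measureReal_mono fun ω hω => ?_).trans (h.trans_eq ?_)
  · simp only [Set.mem_ofPred_eq, hY, Finset.sum_sub_distrib, Finset.sum_const, Finset.card_range,
      nsmul_eq_mul] at hω ⊢
    linarith
  · congr 1
    rcases Nat.eq_zero_or_pos n with rfl | hn
    · simp
    have : (n : ℝ) ≠ 0 := by positivity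
    simp only [zero_sub, neg_neg, NNReal.coe_pow, NNReal.coe_div, coe_nnnorm, Real.norm_eq_abs,
      div_pow, sq_abs]
    rcases eq_or_ne b 0 with rfl | hb
    · simp
    norm_num
    field_simp
    norm_num

end Concentration

/-! ### Conditioning on variables with countably many values. -/

section CountableFibers

variable {Ω α β : Type*}

/-- `Y` has countably many values and its level sets are measurable. -/
structure CountablyFibered (m : MeasurableSpace Ω) (Y : Ω → β) : Prop where
  countable_range : (Set.range Y).Countable
  measurableSet_fiber : ∀ y, MeasurableSet[m] (Y ⁻¹' {y})

/-- The set A is arbitrary, so no measurability is needed of G or of the maps defining the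
iteration. -/
theorem CountablyFibered.measurableSet_preimage {m : MeasurableSpace Ω} {Y : Ω → β}
    (hY : CountablyFibered m Y) (A : Set β) : MeasurableSet[m] (Y ⁻¹' A) := by
  have : Y ⁻¹' A = ⋃ y ∈ Set.range Y ∩ A, Y ⁻¹' {y} := by
    ext ω; simp
  rw [this]
  exact MeasurableSet.biUnion (hY.countable_range.mono Set.inter_subset_left)
    fun y _ => hY.measurableSet_fiber y

theorem CountablyFibered.comp {m : MeasurableSpace Ω} {Y : Ω → β} (hY : CountablyFibered m Y)
    (φ : β → α) : CountablyFibered m (fun ω => φ (Y ω)) where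
  countable_range := by
    have : Set.range (fun ω => φ (Y ω)) = φ '' Set.range Y := Set.range_comp φ Y
    rw [this]
    exact hY.countable_range.image φ
  measurableSet_fiber y := hY.measurableSet_preimage (φ ⁻¹' {y})

theorem CountablyFibered.prodMk {m : MeasurableSpace Ω} {Y : Ω → β} {Z : Ω → α}
    (hY : CountablyFibered m Y) (hZ : CountablyFibered m Z) :
    CountablyFibered m (fun ω => (Y ω, Z ω)) where
  countable_range := (hY.countable_range.prod hZ.countable_range).mono (by
    rintro _ ⟨ω, rfl⟩; exact ⟨⟨ω, rfl⟩, ⟨ω, rfl⟩⟩)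
  measurableSet_fiber y := by
    have : (fun ω => (Y ω, Z ω)) ⁻¹' {y} = Y ⁻¹' {y.1} ∩ Z ⁻¹' {y.2} := by
      ext ω; simp [Prod.ext_iff]
    rw [this]
    exact (hY.measurableSet_fiber _).inter (hZ.measurableSet_fiber _)

theorem CountablyFibered.mono {m m' : MeasurableSpace Ω} {Y : Ω → β}
    (hY : CountablyFibered m Y) (h : m ≤ m') : CountablyFibered m' Y :=
  ⟨hY.countable_range, fun y => h _ (hY.measurableSet_fiber y)⟩

theorem CountablyFibered.of_measurable {m : MeasurableSpace Ω} [Countable β] [MeasurableSpace β]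
    [MeasurableSingletonClass β] {Y : Ω → β} (hY : Measurable[m] Y) : CountablyFibered m Y :=
  ⟨Set.to_countable _, fun y => hY (measurableSet_singleton y)⟩

/-- A batch of random size is recorded as a list because lists over a countable type are countable,
while infinite sequences of draws need not be. -/
theorem CountablyFibered.listOfFn {m : MeasurableSpace Ω} [Countable β] [MeasurableSpace β]
    [MeasurableSingletonClass β] {s : Ω → ℕ} {X : ℕ → Ω → β} (hs : Measurable[m] s)
    (hX : ∀ j, Measurable[m] (X j)) :
    CountablyFibered m (fun ω => List.ofFn fun j : Fin (s ω) => X j ω) where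
  countable_range := Set.to_countable _
  measurableSet_fiber l := by
    have : (fun ω => List.ofFn fun j : Fin (s ω) => X j ω) ⁻¹' {l} =
        s ⁻¹' {l.length} ∩ ⋂ j : Fin l.length, X j ⁻¹' {l[j]} := by
      ext ω
      simp only [Set.mem_preimage, Set.mem_singleton_iff, Set.mem_inter_iff, Set.mem_iInter]
      constructor
      · rintro rfl
        simp
      · rintro ⟨h1, h2⟩
        apply List.ext_getElem
        · simpa using h1
        · intro i hi hi'
          simpa using h2 ⟨i, hi'⟩
    rw [this]
    exact (hs (measurableSet_singleton _)).inter
      (MeasurableSet.iInter fun j => hX j (measurableSet_singleton _))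

/-- If, whatever the value of `Y`, an event independent of `Y` has probability at least `c`, then
so it does jointly with `Y`. -/
theorem mul_measureReal_preimage_le {m₁ m₂ mΩ : MeasurableSpace Ω} {μ : Measure Ω}
    [IsProbabilityMeasure μ] (h₁ : m₁ ≤ mΩ) (h₂ : m₂ ≤ mΩ)
    (hind : Indep m₁ m₂ μ) {Y : Ω → β} (hY : CountablyFibered m₁ Y) {A : Set β} {C : β → Set Ω}
    (hC : ∀ y ∈ A, MeasurableSet[m₂] (C y)) {c : ℝ} (hc : ∀ y ∈ A, c ≤ μ.real (C y)) :
    c * μ.real (Y ⁻¹' A) ≤ μ.real {ω | Y ω ∈ A ∧ ω ∈ C (Y ω)} := by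
  set R := Set.range Y ∩ A with hR
  have hRc : R.Countable := hY.countable_range.mono Set.inter_subset_left
  have e1 : Y ⁻¹' A = ⋃ y ∈ R, Y ⁻¹' {y} := by ext ω; simp [hR]
  have e2 : {ω | Y ω ∈ A ∧ ω ∈ C (Y ω)} = ⋃ y ∈ R, Y ⁻¹' {y} ∩ C y := by
    ext ω; simp [hR]
  have hd : R.PairwiseDisjoint fun y => Y ⁻¹' {y} := fun y _ z _ hyz =>
    Disjoint.preimage Y (by simpa using hyz)
  have hY' : ∀ y, MeasurableSet[mΩ] (Y ⁻¹' {y}) := fun y => h₁ _ (hY.measurableSet_fiber y)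
  have key : ENNReal.ofReal c * μ (Y ⁻¹' A) ≤ μ {ω | Y ω ∈ A ∧ ω ∈ C (Y ω)} := by
    rw [e1, e2, measure_biUnion hRc hd fun y _ => hY' y,
      measure_biUnion hRc (hd.mono fun y => Set.inter_subset_left)
        fun y hy => (hY' y).inter (h₂ _ (hC y hy.2)), ← ENNReal.tsum_mul_left]
    refine ENNReal.tsum_le_tsum fun ⟨y, hy⟩ => ?_
    rw [Indep_iff] at hind
    rw [hind _ _ (hY.measurableSet_fiber y) (hC y hy.2), mul_comm]
    gcongr
    exact (ENNReal.ofReal_le_iff_le_toReal (measure_ne_top _ _)).2 (hc y hy.2)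
  have := ENNReal.toReal_mono (measure_ne_top _ _) key
  rw [ENNReal.toReal_mul, ENNReal.toReal_ofReal'] at this
  exact (mul_le_mul_of_nonneg_right (le_max_left _ _) ENNReal.toReal_nonneg).trans this

end CountableFibers

/-! ### Accuracy of the sampled gradient and Hessian. -/

section Batches

variable {d N : ℕ} {f : Fin N → EuclideanSpace ℝ (Fin d) → ℝ}

theorem gradient_const_mul_sum {ι : Type*} (S : Finset ι) (c : ℝ)
    {h : ι → EuclideanSpace ℝ (Fin d) → ℝ} (hh : ∀ i, ContDiff ℝ 2 (h i))
    (x : EuclideanSpace ℝ (Fin d)) :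
    gradient (fun x => c * ∑ i ∈ S, h i x) x = c • ∑ i ∈ S, gradient (h i) x := by
  have hd : ∀ i, DifferentiableAt ℝ (h i) x := fun i =>
    ((hh i).differentiable (by norm_num)) x
  simp only [gradient]
  rw [fderiv_const_mul (DifferentiableAt.fun_sum fun i _ => hd i), fderiv_fun_sum fun i _ => hd i]
  simp

theorem hess_const_mul_sum {ι : Type*} (S : Finset ι) (c : ℝ)
    {h : ι → EuclideanSpace ℝ (Fin d) → ℝ} (hh : ∀ i, ContDiff ℝ 2 (h i))
    (x : EuclideanSpace ℝ (Fin d)) :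
    hess (fun x => c * ∑ i ∈ S, h i x) x = c • ∑ i ∈ S, hess (h i) x := by
  have hd : ∀ i, DifferentiableAt ℝ (gradient (h i)) x := fun i =>
    (((hh i).gradient' (m := 1) (by norm_num)).differentiable (by norm_num)) x
  have : gradient (fun x => c * ∑ i ∈ S, h i x) = fun x => c • ∑ i ∈ S, gradient (h i) x :=
    funext fun x => gradient_const_mul_sum S c hh x
  unfold hess
  rw [this, fderiv_fun_const_smul (DifferentiableAt.fun_sum fun i _ => hd i),
    fderiv_fun_sum fun i _ => hd i]

theorem inner_hess_const_mul_sum {ι : Type*} (S : Finset ι) (c : ℝ)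
    {h : ι → EuclideanSpace ℝ (Fin d) → ℝ} (hh : ∀ i, ContDiff ℝ 2 (h i))
    (x g : EuclideanSpace ℝ (Fin d)) :
    inner ℝ (hess (fun x => c * ∑ i ∈ S, h i x) x g) g =
      c * ∑ i ∈ S, inner ℝ (hess (h i) x g) g := by
  rw [hess_const_mul_sum S c hh]
  simp [inner_smul_left, sum_inner]

theorem batchLoss_congr {σ τ : ℕ → Fin N} {s : ℕ} (h : ∀ j < s, σ j = τ j) :
    batchLoss f σ s = batchLoss f τ s := by
  funext x
  unfold batchLoss
  congr 1
  exact Finset.sum_congr rfl fun j hj => by rw [h j (Finset.mem_range.1 hj)]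

theorem batchLoss_one (i : Fin N) : batchLoss f (fun _ => i) 1 = f i := by
  funext x; simp [batchLoss]

theorem inner_hess_mem_Icc {M : ℝ} (hFS : SampledHessianRegular f M) (i : Fin N)
    (x g : EuclideanSpace ℝ (Fin d)) :
    0 ≤ inner ℝ (hess (f i) x g) g ∧ inner ℝ (hess (f i) x g) g ≤ M * ‖g‖ ^ 2 := by
  have h := hFS 1 one_pos (fun _ => i) x
  rw [batchLoss_one] at h
  exact ⟨inner_nonneg_of_nonneg h.1 g, inner_le_of_le_smul_one h.2 g⟩

/-- The deviation of the sampled gradient sum is at most `√n G (1 + √(8 ln (1/δ)))`. -/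
def GradSampleAccurate (f : Fin N → EuclideanSpace ℝ (Fin d) → ℝ)
    (G : EuclideanSpace ℝ (Fin d) → ℝ) (δ : ℝ) (σ : ℕ → Fin N) (n : ℕ)
    (x : EuclideanSpace ℝ (Fin d)) : Prop :=
  ‖∑ j ∈ Finset.range n, (gradient (f (σ j)) x - (1 / (N : ℝ)) • ∑ a, gradient (f a) x)‖ ≤
    √n * (G x * (1 + √(8 * Real.log (1 / δ))))

/-- The sampled curvature along `g` is at least `1 - ε` times the true curvature. -/
def HessSampleAccurate (f : Fin N → EuclideanSpace ℝ (Fin d) → ℝ) (ε : ℝ) (τ : ℕ → Fin N) (r : ℕ)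
    (x g : EuclideanSpace ℝ (Fin d)) : Prop :=
  (1 - ε) * inner ℝ (hess (fullLoss f) x g) g ≤ inner ℝ (hess (batchLoss f τ r) x g) g

theorem GradSampleAccurate.congr {G : EuclideanSpace ℝ (Fin d) → ℝ} {δ : ℝ} {σ τ : ℕ → Fin N}
    {n : ℕ} {x : EuclideanSpace ℝ (Fin d)} (h : ∀ j < n, σ j = τ j) :
    GradSampleAccurate f G δ σ n x ↔ GradSampleAccurate f G δ τ n x := by
  unfold GradSampleAccurate
  rw [Finset.sum_congr rfl fun j hj => by rw [h j (Finset.mem_range.1 hj)]]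

theorem norm_batch_gradient_sub_le (hf : ∀ i, ContDiff ℝ 2 (f i)) (hN : 0 < N)
    {G : EuclideanSpace ℝ (Fin d) → ℝ} (hG : ∀ i x, ‖gradient (f i) x‖ ≤ G x)
    {ν δ : ℝ} (hν : 0 < ν) {σ : ℕ → Fin N} {n : ℕ} {x : EuclideanSpace ℝ (Fin d)}
    (hA : GradSampleAccurate f G δ σ n x) (hL : GradBatchLargeEnough f G ν δ σ n x) :
    ‖gradient (batchLoss f σ n) x - gradient (fullLoss f) x‖ ≤
      ν * ‖gradient (batchLoss f σ n) x‖ := by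
  have hN' : (0 : ℝ) < N := Nat.cast_pos.2 hN
  have hG0 : 0 ≤ G x := (norm_nonneg _).trans (hG ⟨0, hN⟩ x)
  have hfull : gradient (fullLoss f) x = (1 / (N : ℝ)) • ∑ a, gradient (f a) x :=
    gradient_const_mul_sum _ _ hf x
  have hbatch : gradient (batchLoss f σ n) x =
      (1 / (n : ℝ)) • ∑ j ∈ Finset.range n, gradient (f (σ j)) x :=
    gradient_const_mul_sum _ _ (fun j => hf (σ j)) x
  set g := gradient (batchLoss f σ n) x with hg
  unfold GradSampleAccurate at hA
  unfold GradBatchLargeEnough at hL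
  rw [← hg] at hL
  rw [← hfull] at hA
  set K := 1 + √(8 * Real.log (1 / δ)) with hK
  have hK1 : 1 ≤ K := by
    have := Real.sqrt_nonneg (8 * Real.log (1 / δ)); linarith
  -- An empty batch passes the size condition only if G x = 0, and then every component gradient
  -- vanishes at x.
  rcases Nat.eq_zero_or_pos n with rfl | hn
  · simp only [Nat.cast_zero, zero_mul] at hL
    have hG2 : G x = 0 := by
      have h1 : (G x * K) ^ 2 = 0 := by
        rw [mul_pow]; exact le_antisymm hL (by positivity)
      rcases mul_eq_zero.1 (pow_eq_zero_iff two_ne_zero |>.1 h1) with h | h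
      · exact h
      · linarith
    have h0 : ∀ a, gradient (f a) x = 0 := fun a => norm_le_zero_iff.1 (hG2 ▸ hG a x)
    rw [hfull, hbatch]
    simp [h0]
  · have hn' : (0 : ℝ) < n := Nat.cast_pos.2 hn
    have hsum : ∑ j ∈ Finset.range n, (gradient (f (σ j)) x - gradient (fullLoss f) x) =
        (n : ℝ) • (g - gradient (fullLoss f) x) := by
      rw [Finset.sum_sub_distrib, hbatch, smul_sub, smul_smul, mul_one_div_cancel hn'.ne', one_smul]
      simp [Nat.cast_smul_eq_nsmul]
    rw [hsum, norm_smul, Real.norm_of_nonneg hn'.le] at hA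
    have h2 : G x * K ≤ √n * (ν * ‖g‖) := by
      refine (abs_le_of_sq_le_sq' ?_ (by positivity)).2
      rw [mul_pow, mul_pow (√(n : ℝ)), Real.sq_sqrt hn'.le]
      exact hL
    refine le_of_mul_le_mul_left (hA.trans ?_) hn'
    calc √n * (G x * K) ≤ √n * (√n * (ν * ‖g‖)) := by gcongr
      _ = n * (ν * ‖g‖) := by rw [← mul_assoc, Real.mul_self_sqrt hn'.le]

theorem HessBatchLargeEnough.pos {m M ε p : ℝ} {r : ℕ} (hd : 0 < d) (hm : 0 < m) (hmM : m ≤ M)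
    (hε0 : 0 < ε) (hp0 : 0 < p) (hp1 : p < 1) (h : HessBatchLargeEnough d m M ε p r) : 0 < r := by
  have hd' : (1 : ℝ) ≤ d := by exact_mod_cast hd
  have hlog : 0 < Real.log (2 * (d : ℝ) / p) :=
    Real.log_pos (by rw [lt_div_iff₀ hp0]; linarith)
  have hM : 0 < M := by linarith
  have : (0 : ℝ) < r := lt_of_lt_of_le (by positivity) h
  exact_mod_cast this

/-- The deterministic part of the analysis of one iteration. -/
theorem contraction_of_accurate (hN : 0 < N) (hf : ∀ i, ContDiff ℝ 2 (f i)) {m M : ℝ}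
    (hF : HessianRegular f m M) (hFS : SampledHessianRegular f M)
    (hsc : SelfConcordant 2 (fullLoss f)) {G : EuclideanSpace ℝ (Fin d) → ℝ}
    (hG : ∀ i x, ‖gradient (f i) x‖ ≤ G x) {xstar : EuclideanSpace ℝ (Fin d)}
    (hxstar : ∀ y, fullLoss f xstar ≤ fullLoss f y) {γ ν ε δ : ℝ} (hγ : 0 < γ) (hν0 : 0 < ν)
    (hν1 : ν < 1) (hε1 : ε < 1) {σ τ : ℕ → Fin N} {n r : ℕ} (hr : 0 < r)
    {x : EuclideanSpace ℝ (Fin d)} (hγx : ‖gradient (fullLoss f) x‖ ≤ γ)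
    (hA : GradSampleAccurate f G δ σ n x) (hL : GradBatchLargeEnough f G ν δ σ n x)
    (hB : HessSampleAccurate f ε τ r x (gradient (batchLoss f σ n) x)) :
    fullLoss f (x - stepSize f ε σ n τ r x • gradient (batchLoss f σ n) x) - fullLoss f xstar ≤
      contractionFactor m M γ ν ε * (fullLoss f x - fullLoss f xstar) := by
  unfold stepSize
  dsimp only
  set g := gradient (batchLoss f σ n) x
  have h1ε : 0 < 1 - ε := by linarith
  have hq := hFS r hr τ x
  have hq0 : 0 ≤ inner ℝ (hess (batchLoss f τ r) x g) g := inner_nonneg_of_nonneg hq.1 g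
  have hD2 : (√(inner ℝ g (hess (batchLoss f τ r) x g)) / √(1 - ε)) ^ 2 =
      inner ℝ (hess (batchLoss f τ r) x g) g / (1 - ε) := by
    rw [real_inner_comm, div_pow, Real.sq_sqrt hq0, Real.sq_sqrt h1ε.le]
  refine contraction_step hsc hF.1 hF.2.1 (fun x => (hF.2.2 x).1) hxstar hγ hν0 hν1 hε1
    (norm_batch_gradient_sub_le hf hN hG hν0 hA hL) hγx (by positivity) ?_ ?_
  · rw [hD2, le_div_iff₀ h1ε, mul_comm]
    exact hB
  · rw [hD2, div_mul_cancel₀ _ h1ε.ne']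
    exact inner_le_of_le_smul_one hq.2 g

variable {Ω : Type*} [MeasurableSpace Ω] {μ : Measure Ω} [IsProbabilityMeasure μ]

theorem measureReal_gradSampleAccurate_ge (hN : 0 < N) {ξ : ℕ → Ω → Fin N}
    (hξ : ∀ j, Measurable (ξ j)) (hu : ∀ j, μ.map (ξ j) = uniformOn Set.univ)
    (hind : iIndepFun ξ μ) {G : EuclideanSpace ℝ (Fin d) → ℝ}
    (hG : ∀ i x, ‖gradient (f i) x‖ ≤ G x) {δ : ℝ} (hδ0 : 0 < δ) (hδ1 : δ < 1) (n : ℕ)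
    (x : EuclideanSpace ℝ (Fin d))
    (hmeas : MeasurableSet {ω | GradSampleAccurate f G δ (fun j => ξ j ω) n x}) :
    1 - δ ≤ μ.real {ω | GradSampleAccurate f G δ (fun j => ξ j ω) n x} := by
  have h := measureReal_norm_sum_gt_le hN hξ hu hind (fun a => hG a x) hδ0 hδ1 n
  have hc : {ω | GradSampleAccurate f G δ (fun j => ξ j ω) n x}ᶜ = {ω | √n * (G x *
      (1 + √(8 * Real.log (1 / δ)))) < ‖∑ j ∈ Finset.range n, (gradient (f (ξ j ω)) x -
        (1 / (N : ℝ)) • ∑ a, gradient (f a) x)‖} := by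
    ext ω; simp [GradSampleAccurate]
  rw [← hc, probReal_compl_eq_one_sub hmeas] at h
  linarith

/-- For fixed g the component curvatures are numbers in [0, M‖g‖²] with mean Q ≥ m‖g‖², so the
scalar lower tail with deviation εQ applies. Its exponent is at least 32 ln(2d/p), more than the
needed ln(1/p). -/
theorem measureReal_hessSampleAccurate_ge (hd : 0 < d) {ζ : ℕ → Ω → Fin N}
    (hζ : ∀ j, Measurable (ζ j)) (hu : ∀ j, μ.map (ζ j) = uniformOn Set.univ)
    (hind : iIndepFun ζ μ) (hf : ∀ i, ContDiff ℝ 2 (f i)) {m M : ℝ}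
    (hF : HessianRegular f m M) (hFS : SampledHessianRegular f M) {ε p : ℝ}
    (hε0 : 0 < ε) (hp0 : 0 < p) (hp1 : p < 1) {r : ℕ}
    (hr : HessBatchLargeEnough d m M ε p r) (x g : EuclideanSpace ℝ (Fin d))
    (hmeas : MeasurableSet {ω | HessSampleAccurate f ε (fun j => ζ j ω) r x g}) :
    1 - p ≤ μ.real {ω | HessSampleAccurate f ε (fun j => ζ j ω) r x g} := by
  obtain ⟨hm, hmM, hF⟩ := hF
  have hM : 0 < M := by linarith
  have hrpos : (0 : ℝ) < r := Nat.cast_pos.2 (hr.pos hd hm hmM hε0 hp0 hp1)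
  have hfull : inner ℝ (hess (fullLoss f) x g) g =
      (1 / (N : ℝ)) * ∑ a, inner ℝ (hess (f a) x g) g := inner_hess_const_mul_sum _ _ hf x g
  have hbatch : ∀ ω, inner ℝ (hess (batchLoss f (fun j => ζ j ω) r) x g) g =
      (1 / (r : ℝ)) * ∑ j ∈ Finset.range r, inner ℝ (hess (f (ζ j ω)) x g) g := fun ω =>
    inner_hess_const_mul_sum _ _ (fun j => hf (ζ j ω)) x g
  set Q := inner ℝ (hess (fullLoss f) x g) g with hQ
  have hmQ : m * ‖g‖ ^ 2 ≤ Q := le_inner_of_smul_one_le (hF x).1 g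
  have hQ0 : 0 ≤ Q := le_trans (by positivity) hmQ
  by_cases hg : g = 0
  · have : {ω | HessSampleAccurate f ε (fun j => ζ j ω) r x g} = Set.univ := by
      ext ω; simp [HessSampleAccurate, hg]
    rw [this, probReal_univ]
    linarith
  have hng : 0 < ‖g‖ := norm_pos_iff.2 hg
  have h := measureReal_sum_lt_le hζ hu hind (fun a => (inner_hess_mem_Icc hFS a x g).1)
    (fun a => (inner_hess_mem_Icc hFS a x g).2) (t := ε * Q) (by positivity) r
  rw [← hfull] at h
  have hc : {ω | HessSampleAccurate f ε (fun j => ζ j ω) r x g}ᶜ =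
      {ω | ∑ j ∈ Finset.range r, inner ℝ (hess (f (ζ j ω)) x g) g < r * Q - r * (ε * Q)} := by
    ext ω
    simp only [Set.mem_compl_iff, Set.mem_ofPred_eq, HessSampleAccurate, not_le, hbatch, ← hQ]
    rw [one_div, inv_mul_lt_iff₀ hrpos]
    have : (r : ℝ) * ((1 - ε) * Q) = r * Q - r * (ε * Q) := by ring
    rw [this]
  rw [← hc, probReal_compl_eq_one_sub hmeas] at h
  have hexp : Real.exp (-(2 * r * (ε * Q) ^ 2 / (M * ‖g‖ ^ 2) ^ 2)) ≤ p := by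
    have hd' : (1 : ℝ) ≤ d := by exact_mod_cast hd
    have h1 : Real.log (1 / p) ≤ Real.log (2 * (d : ℝ) / p) :=
      Real.log_le_log (by positivity) (by gcongr; linarith)
    have h0 : 0 < Real.log (1 / p) :=
      Real.log_pos (by rw [one_div]; exact (one_lt_inv₀ hp0).2 hp1)
    have h2 : Real.log (1 / p) ≤ 2 * r * (ε * Q) ^ 2 / (M * ‖g‖ ^ 2) ^ 2 := by
      calc Real.log (1 / p) ≤ 32 * Real.log (2 * (d : ℝ) / p) := by linarith
        _ = 2 * (16 * (M / m) ^ 2 * Real.log (2 * (d : ℝ) / p) / ε ^ 2) *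
            (ε * (m * ‖g‖ ^ 2)) ^ 2 / (M * ‖g‖ ^ 2) ^ 2 := by field_simp; ring
        _ ≤ _ := by
          have := hr
          unfold HessBatchLargeEnough at this
          gcongr
    calc Real.exp (-(2 * r * (ε * Q) ^ 2 / (M * ‖g‖ ^ 2) ^ 2))
        ≤ Real.exp (-Real.log (1 / p)) := Real.exp_le_exp.2 (neg_le_neg h2)
      _ = p := by rw [one_div, Real.log_inv, neg_neg, Real.exp_log hp0]
  linarith

end Batches

/-! ### Measurability of the iterates and independence of the draws. -/

section Draws

variable {d N : ℕ} {f : Fin N → EuclideanSpace ℝ (Fin d) → ℝ} {Ω : Type*}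

/-- The batch listed by `l`, continued by a constant. -/
def batchOfList (i : Fin N) (l : List (Fin N)) (j : ℕ) : Fin N := l.getD j i

theorem batchOfList_ofFn (i : Fin N) (σ : ℕ → Fin N) (n : ℕ) :
    ∀ j < n, batchOfList i (List.ofFn fun j : Fin n => σ j) j = σ j := fun j hj => by
  simp [batchOfList, hj]

theorem stepSize_congr {ε : ℝ} {σ σ' τ τ' : ℕ → Fin N} {s r : ℕ} (hσ : ∀ j < s, σ j = σ' j)
    (hτ : ∀ j < r, τ j = τ' j) (x : EuclideanSpace ℝ (Fin d)) :
    stepSize f ε σ s τ r x = stepSize f ε σ' s τ' r x := by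
  unfold stepSize
  rw [batchLoss_congr hσ, batchLoss_congr hτ]

theorem history_mono (ξ ζ : ℕ → ℕ → Ω → Fin N) {k l : ℕ} (h : k ≤ l) :
    history ξ ζ k ≤ history ξ ζ l :=
  iSup_mono fun _ => iSup_mono' fun hi => ⟨hi.trans_le h, le_rfl⟩

theorem comap_le_history (ξ ζ : ℕ → ℕ → Ω → Fin N) (k j : ℕ) :
    MeasurableSpace.comap (ξ k j) ⊤ ⊔ MeasurableSpace.comap (ζ k j) ⊤ ≤ history ξ ζ (k + 1) :=
  le_iSup_of_le k (le_iSup_of_le k.lt_succ_self (le_iSup_of_le j le_rfl))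

theorem countablyFibered_iterates (hN : 0 < N) {ε : ℝ} {x₀ : EuclideanSpace ℝ (Fin d)}
    {ξ ζ : ℕ → ℕ → Ω → Fin N} {s r : ℕ → Ω → ℕ}
    (hs : ∀ k, Measurable[history ξ ζ k] (s k)) (hr : ∀ k, Measurable[history ξ ζ k] (r k))
    (k : ℕ) : CountablyFibered (history ξ ζ k) (iterates f ε x₀ ξ ζ s r k) := by
  induction k with
  | zero =>
    refine ⟨(Set.countable_singleton x₀).mono (Set.range_subset_iff.2 fun ω => rfl), fun y => ?_⟩
    exact @MeasurableSet.const Ω (history ξ ζ 0) (x₀ = y)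
  | succ k ih =>
    have hle := history_mono ξ ζ (Nat.le_add_right k 1)
    have hs' : Measurable[history ξ ζ (k + 1)] (s k) := (hs k).mono hle le_rfl
    have hr' : Measurable[history ξ ζ (k + 1)] (r k) := (hr k).mono hle le_rfl
    have hξ' : ∀ j, Measurable[history ξ ζ (k + 1)] (ξ k j) := fun j =>
      measurable_iff_comap_le.2 (le_sup_left.trans (comap_le_history ξ ζ k j))
    have hζ' : ∀ j, Measurable[history ξ ζ (k + 1)] (ζ k j) := fun j =>
      measurable_iff_comap_le.2 (le_sup_right.trans (comap_le_history ξ ζ k j))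
    let i₀ : Fin N := ⟨0, hN⟩
    have h := ((ih.mono hle).prodMk ((CountablyFibered.of_measurable hs').prodMk
      ((CountablyFibered.of_measurable hr').prodMk ((CountablyFibered.listOfFn hs' hξ').prodMk
        (CountablyFibered.listOfFn hr' hζ'))))).comp (fun q : EuclideanSpace ℝ (Fin d) × ℕ × ℕ ×
        List (Fin N) × List (Fin N) => q.1 - stepSize f ε (batchOfList i₀ q.2.2.2.1) q.2.1
          (batchOfList i₀ q.2.2.2.2) q.2.2.1 q.1 •
            gradient (batchLoss f (batchOfList i₀ q.2.2.2.1) q.2.1) q.1)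
    convert h using 1
    funext ω
    simp only [iterates]
    rw [batchLoss_congr (batchOfList_ofFn i₀ (fun j => ξ k j ω) (s k ω)),
      stepSize_congr (batchOfList_ofFn i₀ (fun j => ξ k j ω) (s k ω))
        (batchOfList_ofFn i₀ (fun j => ζ k j ω) (r k ω))]

/-- A property of the first `n` draws is an event of the σ-algebra generated by the draws. -/
theorem measurableSet_of_dependsOn {m : MeasurableSpace Ω} {X : ℕ → Ω → Fin N}
    (hX : ∀ j, Measurable[m] (X j)) (hN : 0 < N) {P : (ℕ → Fin N) → Prop} {n : ℕ}
    (hP : ∀ σ τ : ℕ → Fin N, (∀ j < n, σ j = τ j) → (P σ ↔ P τ)) :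
    MeasurableSet[m] {ω | P fun j => X j ω} := by
  have h := (CountablyFibered.listOfFn (s := fun _ => n) measurable_const hX).measurableSet_preimage
    {l | P (batchOfList ⟨0, hN⟩ l)}
  convert h using 1
  ext ω
  exact hP _ _ fun j hj => (batchOfList_ofFn _ (fun j => X j ω) n j hj).symm

theorem history_le_iSup (ξ ζ : ℕ → ℕ → Ω → Fin N) (k : ℕ) {S : Set ((ℕ × ℕ) ⊕ (ℕ × ℕ))}
    (hS : ∀ i < k, ∀ j, Sum.inl (i, j) ∈ S ∧ Sum.inr (i, j) ∈ S) :
    history ξ ζ k ≤ ⨆ q ∈ S, MeasurableSpace.comap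
        (Sum.elim (fun a : ℕ × ℕ => ξ a.1 a.2) (fun a => ζ a.1 a.2) q) ⊤ :=
  iSup_le fun i => iSup_le fun hi => iSup_le fun j => sup_le
    (le_iSup₂_of_le (Sum.inl (i, j)) (hS i hi j).1 le_rfl)
    (le_iSup₂_of_le (Sum.inr (i, j)) (hS i hi j).2 le_rfl)

variable [MeasurableSpace Ω] {μ : Measure Ω} {ξ ζ : ℕ → ℕ → Ω → Fin N}

theorem UniformDraws.history_le (h : UniformDraws μ ξ ζ) (k : ℕ) :
    history ξ ζ k ≤ ‹MeasurableSpace Ω› :=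
  iSup_le fun _ => iSup_le fun _ => iSup_le fun _ =>
    sup_le (h.measurable_grad _ _).comap_le (h.measurable_hess _ _).comap_le

theorem UniformDraws.indep_grad (h : UniformDraws μ ξ ζ) (k : ℕ) : iIndepFun (ξ k) μ :=
  h.indep.precomp (g := fun j => Sum.inl (k, j)) fun i j hij => by simpa using hij

theorem UniformDraws.indep_hess (h : UniformDraws μ ξ ζ) (k : ℕ) : iIndepFun (ζ k) μ :=
  h.indep.precomp (g := fun j => Sum.inr (k, j)) fun i j hij => by simpa using hij

theorem UniformDraws.indep_iSup (h : UniformDraws μ ξ ζ) {S T : Set ((ℕ × ℕ) ⊕ (ℕ × ℕ))}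
    (hST : Disjoint S T) :
    Indep (⨆ q ∈ S, MeasurableSpace.comap
        (Sum.elim (fun a : ℕ × ℕ => ξ a.1 a.2) (fun a => ζ a.1 a.2) q) ⊤)
      (⨆ q ∈ T, MeasurableSpace.comap
        (Sum.elim (fun a : ℕ × ℕ => ξ a.1 a.2) (fun a => ζ a.1 a.2) q) ⊤) μ := by
  refine indep_iSup_of_disjoint (fun q => ?_) h.indep.iIndep hST
  rcases q with a | a
  · exact (h.measurable_grad a.1 a.2).comap_le
  · exact (h.measurable_hess a.1 a.2).comap_le

theorem UniformDraws.indep_history_grad (h : UniformDraws μ ξ ζ) (k : ℕ) :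
    Indep (history ξ ζ k) (⨆ j, MeasurableSpace.comap (ξ k j) ⊤) μ := by
  have hST : Disjoint {q : (ℕ × ℕ) ⊕ (ℕ × ℕ) | Sum.elim Prod.fst Prod.fst q < k}
      (Set.range fun j => Sum.inl (k, j)) := by
    rw [Set.disjoint_right]
    rintro _ ⟨j, rfl⟩
    simp
  exact indep_of_indep_of_le_left (indep_of_indep_of_le_right (h.indep_iSup hST)
    (iSup_le fun j => le_iSup₂_of_le (Sum.inl (k, j)) ⟨j, rfl⟩ le_rfl))
    (history_le_iSup ξ ζ k fun i hi j => ⟨hi, hi⟩)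

/-- The gradient draws join the past here because the direction along which the Hessian is sampled
is computed from them. -/
theorem UniformDraws.indep_history_sup_grad_hess (h : UniformDraws μ ξ ζ) (k : ℕ) :
    Indep (history ξ ζ k ⊔ ⨆ j, MeasurableSpace.comap (ξ k j) ⊤)
      (⨆ j, MeasurableSpace.comap (ζ k j) ⊤) μ := by
  have hST : Disjoint ({q : (ℕ × ℕ) ⊕ (ℕ × ℕ) | Sum.elim Prod.fst Prod.fst q < k} ∪
      Set.range fun j => Sum.inl (k, j)) (Set.range fun j => Sum.inr (k, j)) := by
    rw [Set.disjoint_right]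
    rintro _ ⟨j, rfl⟩
    simp
  exact indep_of_indep_of_le_left (indep_of_indep_of_le_right (h.indep_iSup hST)
    (iSup_le fun j => le_iSup₂_of_le (Sum.inr (k, j)) ⟨j, rfl⟩ le_rfl))
    (sup_le (history_le_iSup ξ ζ k fun i hi j => ⟨Or.inl hi, Or.inl hi⟩)
      (iSup_le fun j => le_iSup₂_of_le (Sum.inl (k, j)) (Or.inr ⟨j, rfl⟩) le_rfl))

end Draws

/-! ### The probabilistic contraction theorem. -/

theorem theorem1 {d N : ℕ} (hN : 0 < N)
    -- the component functions, with regular full and sampled Hessians and self-concordant average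
    (f : Fin N → EuclideanSpace ℝ (Fin d) → ℝ)
    (hf : ∀ i, ContDiff ℝ 2 (f i))
    (m M : ℝ)
    (hF : HessianRegular f m M)
    (hFS : SampledHessianRegular f M)
    (hsc : SelfConcordant 2 (fullLoss f))
    -- the bound on the component gradients, and a minimizer
    (G : EuclideanSpace ℝ (Fin d) → ℝ)
    (hG : ∀ i x, ‖gradient (f i) x‖ ≤ G x)
    (xstar : EuclideanSpace ℝ (Fin d))
    (hxstar : ∀ y, fullLoss f xstar ≤ fullLoss f y)
    -- the parameters
    (γ ν ε p δ : ℝ)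
    (hγ : 0 < γ) (hν0 : 0 < ν) (hν1 : ν < 1) (hνγ : ν * γ < 1)
    (hε0 : 0 < ε) (hε1 : ε < 1) (hp0 : 0 < p) (hp1 : p < 1) (hδ0 : 0 < δ) (hδ1 : δ < 1)
    -- the random draws; batch sizes are decided before the batches are drawn
    {Ω : Type*} [MeasurableSpace Ω] (μ : Measure Ω) [IsProbabilityMeasure μ]
    (ξ ζ : ℕ → ℕ → Ω → Fin N) (hdraws : UniformDraws μ ξ ζ)
    (s r : ℕ → Ω → ℕ)
    (hs : ∀ k, Measurable[history ξ ζ k] (s k))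
    (hr : ∀ k, Measurable[history ξ ζ k] (r k))
    (x₀ : EuclideanSpace ℝ (Fin d))
    -- the gradients stay bounded by γ along the iterates
    (hbdd : ∀ᵐ ω ∂μ, ∀ k, ‖gradient (fullLoss f) (iterates f ε x₀ ξ ζ s r k ω)‖ ≤ γ)
    -- an iteration whose Hessian batch is large enough
    (k : ℕ)
    (hX : ∀ᵐ ω ∂μ, HessBatchLargeEnough d m M ε p (r k ω)) :
    -- if the gradient batch is large enough, one step contracts with the stated probability
    ((∀ᵐ ω ∂μ, GradBatchLargeEnough f G ν δ (fun j => ξ k j ω) (s k ω)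
        (iterates f ε x₀ ξ ζ s r k ω)) →
      (1 - p) * (1 - δ) ≤ μ.real {ω |
        fullLoss f (iterates f ε x₀ ξ ζ s r (k + 1) ω) - fullLoss f xstar ≤
          contractionFactor m M γ ν ε *
            (fullLoss f (iterates f ε x₀ ξ ζ s r k ω) - fullLoss f xstar)}) ∧
    -- and in general, the same holds with the requirement on the drawn batch inside the event
    (1 - p) * (1 - δ) ≤ μ.real {ω |
      GradBatchLargeEnough f G ν δ (fun j => ξ k j ω) (s k ω) (iterates f ε x₀ ξ ζ s r k ω) →
        fullLoss f (iterates f ε x₀ ξ ζ s r (k + 1) ω) - fullLoss f xstar ≤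
          contractionFactor m M γ ν ε *
            (fullLoss f (iterates f ε x₀ ξ ζ s r k ω) - fullLoss f xstar)} := by
  set x := iterates f ε x₀ ξ ζ s r k with hx
  have hstep : ∀ ω, iterates f ε x₀ ξ ζ s r (k + 1) ω =
      x ω - stepSize f ε (fun j => ξ k j ω) (s k ω) (fun j => ζ k j ω) (r k ω) (x ω) •
        gradient (batchLoss f (fun j => ξ k j ω) (s k ω)) (x ω) := fun ω => rfl
  suffices hmain : (1 - p) * (1 - δ) ≤ μ.real {ω |
      GradBatchLargeEnough f G ν δ (fun j => ξ k j ω) (s k ω) (x ω) →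
        fullLoss f (iterates f ε x₀ ξ ζ s r (k + 1) ω) - fullLoss f xstar ≤
          contractionFactor m M γ ν ε * (fullLoss f (x ω) - fullLoss f xstar)} by
    refine ⟨fun hS => hmain.trans_eq (measureReal_congr ?_), hmain⟩
    filter_upwards [hS] with ω hω
    exact propext ⟨fun h => h hω, fun h _ => h⟩
  -- For d = 0 the logarithm ln(2d/p) takes the default value 0, so the Hessian batch may be empty;
  -- but the space is a point and both gaps are zero.
  rcases Nat.eq_zero_or_pos d with rfl | hd
  · have hall : ∀ y, fullLoss f y = fullLoss f xstar := fun y => by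
      rw [Subsingleton.elim y xstar]
    simp only [hall, sub_self, mul_zero, le_refl, implies_true, Set.ofPred_true, probReal_univ]
    nlinarith
  let i₀ : Fin N := ⟨0, hN⟩
  have hxf : CountablyFibered (history ξ ζ k) x := countablyFibered_iterates hN hs hr k
  have hξm : ∀ j, Measurable[⨆ j, MeasurableSpace.comap (ξ k j) ⊤] (ξ k j) := fun j =>
    measurable_iff_comap_le.2 (le_iSup (fun j => MeasurableSpace.comap (ξ k j) ⊤) j)
  have hζm : ∀ j, Measurable[⨆ j, MeasurableSpace.comap (ζ k j) ⊤] (ζ k j) := fun j =>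
    measurable_iff_comap_le.2 (le_iSup (fun j => MeasurableSpace.comap (ζ k j) ⊤) j)
  have hξle : (⨆ j, MeasurableSpace.comap (ξ k j) ⊤) ≤ ‹MeasurableSpace Ω› :=
    iSup_le fun j => (hdraws.measurable_grad k j).comap_le
  have hζle : (⨆ j, MeasurableSpace.comap (ζ k j) ⊤) ≤ ‹MeasurableSpace Ω› :=
    iSup_le fun j => (hdraws.measurable_hess k j).comap_le
  have hhist := hdraws.history_le k
  have hgm : ∀ y n, MeasurableSet[⨆ j, MeasurableSpace.comap (ξ k j) ⊤]
      {ω | GradSampleAccurate f G δ (fun j => ξ k j ω) n y} := fun y n =>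
    measurableSet_of_dependsOn hξm hN (P := fun σ => GradSampleAccurate f G δ σ n y)
      fun _ _ h => GradSampleAccurate.congr h
  -- Given the past, x_k and |S_k| are constants. Taking `A` to be everything leaves (*) out of the
  -- conditioning.
  have hgrad := mul_measureReal_preimage_le (μ := μ) hhist hξle (hdraws.indep_history_grad k)
    (hxf.prodMk (CountablyFibered.of_measurable (hs k))) (A := Set.univ)
    (C := fun q => {ω | GradSampleAccurate f G δ (fun j => ξ k j ω) q.2 q.1})
    (fun q _ => hgm q.1 q.2) (c := 1 - δ)
    (fun q _ => measureReal_gradSampleAccurate_ge hN (hdraws.measurable_grad k)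
      (hdraws.uniform_grad k) (hdraws.indep_grad k) hG hδ0 hδ1 q.2 q.1 (hξle _ (hgm q.1 q.2)))
  simp only [Set.preimage_univ, probReal_univ, mul_one, Set.mem_univ, true_and,
    Set.mem_ofPred_eq] at hgrad
  have hhm : ∀ n y g, MeasurableSet[⨆ j, MeasurableSpace.comap (ζ k j) ⊤]
      {ω | HessSampleAccurate f ε (fun j => ζ k j ω) n y g} := fun n y g =>
    measurableSet_of_dependsOn hζm hN (P := fun τ => HessSampleAccurate f ε τ n y g)
      fun σ τ h => by unfold HessSampleAccurate; rw [batchLoss_congr h]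
  have hle : history ξ ζ k ≤ history ξ ζ k ⊔ ⨆ j, MeasurableSpace.comap (ξ k j) ⊤ := le_sup_left
  -- Now the list of gradient draws is fixed as well, hence so is g. Gradient accuracy sits in `A`,
  -- which makes the two probabilities multiply.
  have hhess := mul_measureReal_preimage_le (μ := μ) (sup_le hhist hξle) hζle
    (hdraws.indep_history_sup_grad_hess k)
    ((hxf.mono hle).prodMk (((CountablyFibered.of_measurable (hs k)).mono hle).prodMk
      (((CountablyFibered.of_measurable (hr k)).mono hle).prodMk
        (CountablyFibered.listOfFn ((hs k).mono hle le_rfl)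
          fun j => (hξm j).mono le_sup_right le_rfl))))
    (A := {q | HessBatchLargeEnough d m M ε p q.2.2.1 ∧
      GradSampleAccurate f G δ (batchOfList i₀ q.2.2.2) q.2.1 q.1})
    (C := fun q => {ω | HessSampleAccurate f ε (fun j => ζ k j ω) q.2.2.1 q.1
      (gradient (batchLoss f (batchOfList i₀ q.2.2.2) q.2.1) q.1)})
    (fun q _ => hhm _ _ _) (c := 1 - p)
    (fun q hq => measureReal_hessSampleAccurate_ge hd (hdraws.measurable_hess k)
      (hdraws.uniform_hess k) (hdraws.indep_hess k) hf hF hFS hε0 hp0 hp1 hq.1 _ _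
      (hζle _ (hhm _ _ _)))
  have hbatch : ∀ ω, ∀ j < s k ω,
      batchOfList i₀ (List.ofFn fun j : Fin (s k ω) => ξ k j ω) j = ξ k j ω := fun ω =>
    batchOfList_ofFn i₀ (fun j => ξ k j ω) (s k ω)
  have hgood : (1 - δ) ≤ μ.real ((fun ω => (x ω, s k ω, r k ω,
      List.ofFn fun j : Fin (s k ω) => ξ k j ω)) ⁻¹' {q | HessBatchLargeEnough d m M ε p q.2.2.1 ∧
        GradSampleAccurate f G δ (batchOfList i₀ q.2.2.2) q.2.1 q.1}) := by
    refine hgrad.trans_eq (measureReal_congr ?_)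
    filter_upwards [hX] with ω hω
    refine propext ⟨fun h => ⟨hω, (GradSampleAccurate.congr (hbatch ω)).2 h⟩,
      fun h => (GradSampleAccurate.congr (hbatch ω)).1 h.2⟩
  refine (mul_le_mul_of_nonneg_left hgood (by linarith)).trans (hhess.trans ?_)
  refine ENNReal.toReal_mono (measure_ne_top _ _) (measure_mono_ae ?_)
  filter_upwards [hbdd] with ω hω
  rintro ⟨⟨hXω, hAω⟩, hBω⟩ hL
  rw [hstep]
  simp only [batchLoss_congr (hbatch ω)] at hBω
  exact contraction_of_accurate hN hf hF hFS hsc hG hxstar hγ hν0 hν1 hε1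
    (hXω.pos hd hF.1 hF.2.1 hε0 hp0 hp1) (hω k) ((GradSampleAccurate.congr (hbatch ω)).1 hAω) hL hBω
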